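/- Let $H$ be a real or complex Hilbert space. A spectral family on $H$ is a family $(E(\lambda))_{\lambda\in\mathbb{R}}$ of orthogonal projections on $H$ that is increasing ($E(\lambda)\le E(\mu)$ for $\lambda\le\mu$), strongly right-continuous, and satisfies $E(\lambda)x\to 0$ as $\lambda\to-\infty$ and $E(\lambda)x\to x$ as $\lambda\to\infty$ for every $x\in H$. For an operator $A$ in $H$ with domain $D(A)$, the equation $A=\int_{\mathbb{R}}\lambda\,dE(\lambda)$ means that $$D(A)=\Bigl\{x\in H:\int_{\mathbb{R}}\lambda^2\,d\langle E(\lambda)x,x\rangle<\infty\Bigr\}$$ and that, for all $x\in D(A)$, $$\|Ax\|^2=\int_{\mathbb{R}}\lambda^2\,d\langle E(\lambda)x,x\rangle,\qquad \langle Ax,x\rangle=\int_{\mathbb{R}}\lambda\,d\langle E(\lambda)x,x\rangle .$$ Theorem. Let $A$ be a self-adjoint (possibly unbounded) operator in $H$. Then there is exactly one spectral family $(E(\lambda))_{\lambda\in\mathbb{R}}$ on $H$ such that $A=\int_{\mathbb{R}}\lambda\,dE(\lambda)$. If moreover $A\ge 0$, i.e. $\langle Ax,x\rangle\ge 0$ for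 all $x\in D(A)$, then for every $\lambda\in\mathbb{R}$ the set $$F(A,\lambda)=\Bigl\{x\in\bigcap_{n}D(A^n):\ \|A^nx\|\le\lambda^n\|x\|\text{ for all }n\in\mathbb{N}\Bigr\}$$ is a closed linear subspace of $H$ and $E(\lambda)$ is the orthogonal projection onto it. -/

import Mathlib

open MeasureTheory Filter Topology

/-- A spectral family on a Hilbert space `H` over `𝕜` (`ℝ` or `ℂ`): an increasing,
strongly right-continuous family of orthogonal projections `E(t)`, `t ∈ ℝ`, with
`E(t) → 0` strongly as `t → -∞` and `E(t) → I` strongly as `t → ∞`. -/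
structure SpectralFamily (𝕜 H : Type*) [RCLike 𝕜] [NormedAddCommGroup H]
    [InnerProductSpace 𝕜 H] [CompleteSpace H] where
  /-- The projections `E(t)`. -/
  proj : ℝ → H →L[𝕜] H
  isStarProjection : ∀ t, IsStarProjection (proj t)
  mono : ∀ s t, s ≤ t → proj s ≤ proj t
  right_continuous : ∀ t x, Tendsto (fun s => proj s x) (𝓝[>] t) (𝓝 (proj t x))
  tendsto_atBot : ∀ x, Tendsto (fun t => proj t x) atBot (𝓝 0)
  tendsto_atTop : ∀ x, Tendsto (fun t => proj t x) atTop (𝓝 x)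

namespace SpectralFamily

variable {𝕜 H : Type*} [RCLike 𝕜] [NormedAddCommGroup H] [InnerProductSpace 𝕜 H]
  [CompleteSpace H]

/-- The function `t ↦ ⟨E(t)x, x⟩`, which is real, increasing and right-continuous. -/
def stieltjes (E : SpectralFamily 𝕜 H) (x : H) : StieltjesFunction ℝ where
  toFun t := RCLike.re (inner 𝕜 (E.proj t x) x)
  mono' s t hst := by
    have h := ((ContinuousLinearMap.le_def _ _).1 (E.mono s t hst)).re_inner_nonneg_left x
    simp only [sub_apply, inner_sub_left, map_sub] at h
    linarith
  right_continuous' t := by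
    rw [← continuousWithinAt_Ioi_iff_Ici]
    exact RCLike.continuous_re.continuousAt.tendsto.comp
      ((E.right_continuous t x).inner tendsto_const_nhds)

/-- The Lebesgue-Stieltjes measure `d⟨E(t)x, x⟩` on `ℝ`. -/
noncomputable def measure (E : SpectralFamily 𝕜 H) (x : H) : Measure ℝ :=
  (E.stieltjes x).measure

/-- `A = ∫ t dE(t)`: the domain `D(A)` consists of exactly those `x` with
`∫ t² d⟨E(t)x, x⟩ < ∞`, and for these `‖Ax‖² = ∫ t² d⟨E(t)x, x⟩` and
`⟨Ax, x⟩ = ∫ t d⟨E(t)x, x⟩`. -/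
def Represents (E : SpectralFamily 𝕜 H) (A : H →ₗ.[𝕜] H) : Prop :=
  (∀ x : H, x ∈ A.domain ↔ Integrable (fun t : ℝ => t ^ 2) (E.measure x)) ∧
  ∀ x : A.domain,
    ‖A x‖ ^ 2 = ∫ t : ℝ, t ^ 2 ∂(E.measure (x : H)) ∧
    Integrable (fun t : ℝ => t) (E.measure (x : H)) ∧
    inner 𝕜 (A x) (x : H) = ((∫ t : ℝ, t ∂(E.measure (x : H)) : ℝ) : 𝕜)

end SpectralFamily

namespace LinearPMap

variable {𝕜 H : Type*} [RCLike 𝕜] [NormedAddCommGroup H] [InnerProductSpace 𝕜 H]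

/-- `A ≥ 0`, for a self-adjoint operator `A` (so that `⟨Ax, x⟩` is real):
`⟨Ax, x⟩ ≥ 0` for all `x ∈ D(A)`. -/
def IsNonneg (A : H →ₗ.[𝕜] H) : Prop :=
  ∀ x : A.domain, 0 ≤ RCLike.re (inner 𝕜 (A x) (x : H))

/-- The graph of `Aⁿ`: `IsPowApply A n x y` says that `x ∈ D(Aⁿ)` and `Aⁿ x = y`. -/
def IsPowApply (A : H →ₗ.[𝕜] H) : ℕ → H → H → Prop
  | 0, x, y => y = x
  | n + 1, x, z => ∃ y, IsPowApply A n x y ∧ ∃ hy : y ∈ A.domain, A ⟨y, hy⟩ = z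

/-- `F(A, l) = {x ∈ ⋂ₙ D(Aⁿ) : ‖Aⁿ x‖ ≤ lⁿ ‖x‖ for all n}`. -/
def growthSet (A : H →ₗ.[𝕜] H) (l : ℝ) : Set H :=
  {x | ∀ n : ℕ, ∃ y, IsPowApply A n x y ∧ ‖y‖ ≤ l ^ n * ‖x‖}

end LinearPMap

/-!
# The spectral theorem for unbounded self-adjoint operators

The proof works simultaneously over `ℝ` and `ℂ` and reduces everything to bounded operators.

For self-adjoint `A` the operators `C = (1 + A²)⁻¹` and `B = A (1 + A²)⁻¹` are bounded,
self-adjoint and commute; they come from the orthogonal projection of `(z, 0)` onto the graph of `A`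
(`LinearPMap.exists_isSqResolvent`). The bounded operator `B - t C = (A - t) (1 + A²)⁻¹` has the
same sign as `A - t`, so `E(t)` is defined as its negative spectral projection. That
projection needs only the absolute value of a bounded self-adjoint operator, that is, square roots
of positive operators in the bicommutant (`ContinuousLinearMap.IsPositive.exists_sqrt`), which also
give positivity of products of commuting positive operators. Monotonicity, right continuity and the
limits of `E` all follow from comparing the quadratic forms of `B - t C` for different `t`, because
`C` is positive and injective (`LinearPMap.IsSqResolvent.exists_spectralFamily`).

On the range of `E(b) - E(a)` one has `(A - a) (b - A) ≥ 0`, hence `A` differs from `(a + b) / 2` by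
at most `(b - a) / 2` in norm there. So the increments of `‖A E(t) x‖²` and `⟪A E(t) x, x⟫` agree to
second order with those of the Stieltjes integrals of `t²` and `t`, and a bisection argument
(`sub_eq_setIntegral_of_abs_sub_le`) turns this into equalities on bounded intervals; exhausting the
line gives existence (`IsSelfAdjoint.exists_represents`).

For uniqueness, any spectral family representing `A` commutes with `A`, by polarization of the
formula for `⟪A x, x⟫` (`SpectralFamily.Represents.proj_mem_graph`), hence with the family
constructed above, whose members lie in the bicommutant of `{B, C}`. Two commuting families
representing `A` agree because the form of `A - t` is at most zero on the range of one projection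
and positive on the kernel of the other (`SpectralFamily.Represents.eq_of_commute`).

For `A ≥ 0` the spectral measures are carried by `[0, ∞)`, and the range of `E(l)` consists of the
vectors with `‖Aⁿ x‖ ≤ lⁿ ‖x‖`, since on the kernel of `E(c)` one has `‖Aⁿ x‖ ≥ cⁿ ‖x‖`
(`SpectralFamily.Represents.range_proj_eq_growthSet`).
-/

/-! ### Square roots of bounded positive operators -/

section SqrtIteration

variable {𝕜 R : Type*} [RCLike 𝕜] [NormedRing R] [NormedAlgebra 𝕜 R]

variable (𝕜) in
/-- The iteration `Y₀ = 0`, `Yₙ₊₁ = (X + Yₙ²) / 2`, whose limit `Y` satisfies `(1 - Y)² = 1 - X`. -/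
noncomputable def sqrtIter (X : R) : ℕ → R
  | 0 => 0
  | n + 1 => (2⁻¹ : 𝕜) • (X + sqrtIter X n * sqrtIter X n)

theorem sqrtIter_one_mem_Icc (n : ℕ) : sqrtIter ℝ (1 : ℝ) n ∈ Set.Icc (0 : ℝ) 1 := by
  induction n with
  | zero => simp [sqrtIter]
  | succ n ih =>
    obtain ⟨h0, h1⟩ := ih
    simp only [sqrtIter, smul_eq_mul, Set.mem_Icc]
    constructor <;> nlinarith

theorem norm_sqrtIter_le {X : R} (hX : ‖X‖ ≤ 1) (n : ℕ) :
    ‖sqrtIter 𝕜 X n‖ ≤ sqrtIter ℝ (1 : ℝ) n := by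
  induction n with
  | zero => simp [sqrtIter]
  | succ n ih =>
    have h := norm_mul_le (sqrtIter 𝕜 X n) (sqrtIter 𝕜 X n)
    have h2 := norm_add_le X (sqrtIter 𝕜 X n * sqrtIter 𝕜 X n)
    have h3 := mul_le_mul ih ih (norm_nonneg _) (sqrtIter_one_mem_Icc n).1
    simp only [sqrtIter, norm_smul, norm_inv, RCLike.norm_ofNat, smul_eq_mul]
    linarith

theorem dist_sqrtIter_le {X : R} (hX : ‖X‖ ≤ 1) (n : ℕ) :
    ‖sqrtIter 𝕜 X (n + 1) - sqrtIter 𝕜 X n‖ ≤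
      sqrtIter ℝ (1 : ℝ) (n + 1) - sqrtIter ℝ (1 : ℝ) n := by
  induction n with
  | zero =>
    simp only [sqrtIter, norm_smul, mul_zero, add_zero, sub_zero, norm_inv, RCLike.norm_ofNat,
      smul_eq_mul]
    linarith
  | succ n ih =>
    have e : sqrtIter 𝕜 X (n + 1 + 1) - sqrtIter 𝕜 X (n + 1) = (2⁻¹ : 𝕜) •
        (sqrtIter 𝕜 X (n + 1) * (sqrtIter 𝕜 X (n + 1) - sqrtIter 𝕜 X n) +
          (sqrtIter 𝕜 X (n + 1) - sqrtIter 𝕜 X n) * sqrtIter 𝕜 X n) := by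
      rw [sqrtIter, show sqrtIter 𝕜 X (n + 1) = (2⁻¹ : 𝕜) • (X + sqrtIter 𝕜 X n * sqrtIter 𝕜 X n)
        from rfl, ← smul_sub, ← show sqrtIter 𝕜 X (n + 1) = (2⁻¹ : 𝕜) •
        (X + sqrtIter 𝕜 X n * sqrtIter 𝕜 X n) from rfl]
      congr 1
      noncomm_ring
    have e' : sqrtIter ℝ (1 : ℝ) (n + 1 + 1) - sqrtIter ℝ (1 : ℝ) (n + 1) = 2⁻¹ *
        (sqrtIter ℝ (1 : ℝ) (n + 1) * (sqrtIter ℝ (1 : ℝ) (n + 1) - sqrtIter ℝ (1 : ℝ) n) +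
          (sqrtIter ℝ (1 : ℝ) (n + 1) - sqrtIter ℝ (1 : ℝ) n) * sqrtIter ℝ (1 : ℝ) n) := by
      rw [sqrtIter, show sqrtIter ℝ (1 : ℝ) (n + 1) =
        (2⁻¹ : ℝ) • (1 + sqrtIter ℝ (1 : ℝ) n * sqrtIter ℝ (1 : ℝ) n) from rfl, smul_eq_mul,
        smul_eq_mul]
      ring
    rw [e, e', norm_smul, norm_inv, RCLike.norm_ofNat]
    have h0 := norm_nonneg (sqrtIter 𝕜 X (n + 1) - sqrtIter 𝕜 X n)
    gcongr
    refine (norm_add_le _ _).trans (add_le_add ((norm_mul_le _ _).trans ?_)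
      ((norm_mul_le _ _).trans ?_))
    · exact mul_le_mul (norm_sqrtIter_le hX _) ih h0 (sqrtIter_one_mem_Icc _).1
    · exact mul_le_mul ih (norm_sqrtIter_le hX _) (norm_nonneg _) (h0.trans ih)

variable (𝕜) in
/-- In a Banach algebra, `1 - X` has a square root `1 - Y` with `‖Y‖ ≤ 1` as soon as `‖X‖ ≤ 1`.
The scalar iteration started from `‖X‖ = 1` majorizes the one for `X`, so no strict inequality
is needed for the convergence. -/
theorem exists_tendsto_sqrtIter [CompleteSpace R] {X : R} (hX : ‖X‖ ≤ 1) :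
    ∃ Y : R, Tendsto (sqrtIter 𝕜 X) atTop (𝓝 Y) ∧ ‖Y‖ ≤ 1 ∧ (1 - Y) * (1 - Y) = 1 - X := by
  have hs : Summable fun n => sqrtIter ℝ (1 : ℝ) (n + 1) - sqrtIter ℝ (1 : ℝ) n := by
    refine summable_of_sum_range_le (c := 1)
      (fun n => (norm_nonneg _).trans (dist_sqrtIter_le (𝕜 := 𝕜) hX n)) fun n => ?_
    rw [Finset.sum_range_sub]
    have := (sqrtIter_one_mem_Icc n).2
    simpa [sqrtIter] using this
  have hc : CauchySeq (sqrtIter 𝕜 X) := by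
    refine cauchySeq_of_dist_le_of_summable _ (fun n => ?_) hs
    rw [dist_comm, dist_eq_norm]
    exact dist_sqrtIter_le hX n
  obtain ⟨Y, hY⟩ := cauchySeq_tendsto_of_complete hc
  refine ⟨Y, hY, le_of_tendsto' hY.norm fun n =>
    (norm_sqrtIter_le hX n).trans (sqrtIter_one_mem_Icc n).2, ?_⟩
  have h1 : Tendsto (fun n => sqrtIter 𝕜 X (n + 1)) atTop (𝓝 ((2⁻¹ : 𝕜) • (X + Y * Y))) :=
    ((tendsto_const_nhds.add (hY.mul hY)).const_smul _)
  have h2 := tendsto_nhds_unique (hY.comp (tendsto_add_atTop_nat 1)) h1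
  have h3 : (2 : 𝕜) • Y = X + Y * Y := by
    conv_lhs => rw [h2]
    rw [smul_smul, mul_inv_cancel₀ two_ne_zero, one_smul]
  rw [two_smul] at h3
  have : (1 - Y) * (1 - Y) = 1 - (Y + Y) + Y * Y := by noncomm_ring
  rw [this, h3]
  abel

theorem Commute.sqrtIter_right {X Z : R} (h : Commute Z X) (n : ℕ) :
    Commute Z (sqrtIter 𝕜 X n) := by
  induction n with
  | zero => exact Commute.zero_right Z
  | succ n ih => exact (h.add_right (ih.mul_right ih)).smul_right _

theorem IsSelfAdjoint.sqrtIter [StarRing R] [StarModule 𝕜 R] {X : R}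
    (h : IsSelfAdjoint X) (n : ℕ) : IsSelfAdjoint (sqrtIter 𝕜 X n) := by
  induction n with
  | zero => exact .zero _
  | succ n ih =>
    refine IsSelfAdjoint.smul (by simp [IsSelfAdjoint]) (h.add ?_)
    simpa only [IsSelfAdjoint, star_mul] using by rw [ih.star_eq]

end SqrtIteration

namespace ContinuousLinearMap

variable {𝕜 H : Type*} [RCLike 𝕜] [NormedAddCommGroup H] [InnerProductSpace 𝕜 H]

theorem _root_.Commute.operator_apply {S T : H →L[𝕜] H} (h : Commute S T) (x : H) :
    S (T x) = T (S x) :=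
  DFunLike.congr_fun h.eq x

theorem IsPositive.norm_one_sub_le {T : H →L[𝕜] H} (hT : T.IsPositive) (h1 : ‖T‖ ≤ 1) :
    ‖1 - T‖ ≤ 1 := by
  refine ContinuousLinearMap.opNorm_le_bound _ zero_le_one fun x => ?_
  -- Positivity at `x - T x` gives `‖T x‖² ≤ ⟪T x, x⟫`.
  have h2 := hT.re_inner_nonneg_left (x - T x)
  have h3 : RCLike.re (inner 𝕜 (T (T x)) x) = ‖T x‖ ^ 2 := by
    rw [hT.inner_left_eq_inner_right, inner_self_eq_norm_sq]
  have h4 : RCLike.re (inner 𝕜 (T (T x)) (T x)) ≤ ‖T x‖ ^ 2 := by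
    refine (re_inner_le_norm _ _).trans ?_
    have := (T.le_opNorm (T x)).trans (mul_le_of_le_one_left (norm_nonneg _) h1)
    nlinarith [norm_nonneg (T x)]
  simp only [map_sub, inner_sub_left, inner_sub_right, h3, inner_self_eq_norm_sq] at h2
  have h5 := norm_sub_sq (𝕜 := 𝕜) x (T x)
  have h6 := inner_re_symm (𝕜 := 𝕜) x (T x)
  rw [one_mul]
  refine le_of_sq_le_sq (a := ‖x - T x‖) ?_ (norm_nonneg _)
  rw [h5, h6]
  nlinarith [sq_nonneg ‖T x‖]

variable [CompleteSpace H]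

/-- A positive operator has a positive square root in its bicommutant. The proof works over `ℝ` as
well as over `ℂ`, unlike the continuous functional calculus of complex C⋆-algebras. -/
theorem IsPositive.exists_sqrt {T : H →L[𝕜] H} (hT : T.IsPositive) :
    ∃ R : H →L[𝕜] H, R.IsPositive ∧ R * R = T ∧ ∀ S, Commute S T → Commute S R := by
  set c : ℝ := ‖T‖ + 1 with hc
  have hc0 : 0 < c := by positivity
  set T' : H →L[𝕜] H := ((c⁻¹ : ℝ) : 𝕜) • T with hT'
  have hpos : T'.IsPositive := hT.smul_of_nonneg (by exact_mod_cast (inv_nonneg.2 hc0.le))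
  have hn : ‖T'‖ ≤ 1 := by
    rw [hT', norm_smul, RCLike.norm_ofReal, abs_of_nonneg (inv_nonneg.2 hc0.le),
      inv_mul_le_one₀ hc0]
    linarith
  obtain ⟨Y, hY, hY1, hYY⟩ := exists_tendsto_sqrtIter 𝕜 (hpos.norm_one_sub_le hn)
  have hsa : IsSelfAdjoint Y := by
    have h := fun n => (IsSelfAdjoint.sqrtIter (𝕜 := 𝕜)
      ((IsSelfAdjoint.one (H →L[𝕜] H)).sub hpos.isSelfAdjoint) n).star_eq
    exact tendsto_nhds_unique ((continuous_star.tendsto _).comp hY) (hY.congr fun n => (h n).symm)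
  have hRpos : (1 - Y).IsPositive := by
    rw [isPositive_def']
    refine ⟨(IsSelfAdjoint.one _).sub hsa, fun x => ?_⟩
    have h := (re_inner_le_norm (𝕜 := 𝕜) (Y x) x).trans (mul_le_mul_of_nonneg_right
      ((Y.le_opNorm x).trans (mul_le_of_le_one_left (norm_nonneg _) hY1)) (norm_nonneg x))
    have h1 : RCLike.re (inner 𝕜 ((1 - Y) x) x) = ‖x‖ ^ 2 - RCLike.re (inner 𝕜 (Y x) x) := by
      rw [← inner_self_eq_norm_sq (𝕜 := 𝕜), ← map_sub, ← inner_sub_left]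
      rfl
    rw [reApplyInnerSelf_apply, h1]
    linarith
  refine ⟨((Real.sqrt c : ℝ) : 𝕜) • (1 - Y), hRpos.smul_of_nonneg
    (by exact_mod_cast Real.sqrt_nonneg c), ?_, fun S hS => ?_⟩
  · rw [smul_mul_smul_comm, hYY, sub_sub_cancel, hT', smul_smul, ← RCLike.ofReal_mul,
      ← RCLike.ofReal_mul, Real.mul_self_sqrt hc0.le, mul_inv_cancel₀ hc0.ne', RCLike.ofReal_one,
      one_smul]
  · refine ((Commute.one_right S).sub_right ?_).smul_right _
    have h := fun n => ((((Commute.one_right S).sub_right (hS.smul_right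
      ((c⁻¹ : ℝ) : 𝕜))).sqrtIter_right (𝕜 := 𝕜) n)).eq
    exact tendsto_nhds_unique (hY.const_mul S) ((hY.mul_const S).congr fun n => (h n).symm)

theorem IsPositive.mul_of_commute {S T : H →L[𝕜] H} (hS : S.IsPositive) (hT : T.IsPositive)
    (h : Commute S T) : (S * T).IsPositive := by
  obtain ⟨R, hR, rfl, hRc⟩ := hS.exists_sqrt
  have hc := hRc T h.symm
  have := hT.conj_adjoint R
  rw [hR.isSelfAdjoint.adjoint_eq] at this
  convert this using 1
  change R * R * T = R * (T * R)
  rw [mul_assoc, hc.eq]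

theorem IsPositive.apply_eq_zero {T : H →L[𝕜] H} (hT : T.IsPositive) {x : H}
    (h : RCLike.re (inner 𝕜 (T x) x) ≤ 0) : T x = 0 := by
  obtain ⟨R, hR, rfl, -⟩ := hT.exists_sqrt
  change RCLike.re (inner 𝕜 (R (R x)) x) ≤ 0 at h
  rw [hR.inner_left_eq_inner_right, inner_self_eq_norm_sq] at h
  have h0 : R x = 0 := by simpa using le_antisymm h (sq_nonneg _)
  change R (R x) = 0
  rw [h0, map_zero]

end ContinuousLinearMap

/-! ### Negative spectral projections of bounded operators -/

section StarProjection

variable {𝕜 H : Type*} [RCLike 𝕜] [NormedAddCommGroup H] [InnerProductSpace 𝕜 H] [CompleteSpace H]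

namespace IsStarProjection

variable {P : H →L[𝕜] H}

theorem apply_apply (hP : IsStarProjection P) (x : H) : P (P x) = P x :=
  DFunLike.congr_fun hP.isIdempotentElem.eq x

theorem inner_left (hP : IsStarProjection P) (x y : H) :
    inner 𝕜 (P x) y = inner 𝕜 x (P y) :=
  hP.isSelfAdjoint.isSymmetric x y

theorem re_inner_self (hP : IsStarProjection P) (x : H) :
    RCLike.re (inner 𝕜 (P x) x) = ‖P x‖ ^ 2 := by
  rw [← hP.apply_apply x, hP.inner_left, inner_self_eq_norm_sq, hP.apply_apply]

theorem inner_sub_apply (hP : IsStarProjection P) (x y : H) :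
    inner 𝕜 (P x) (y - P y) = 0 := by
  rw [hP.inner_left, map_sub, hP.apply_apply, sub_self, inner_zero_right]

theorem norm_sub_sq (hP : IsStarProjection P) (x : H) :
    ‖x - P x‖ ^ 2 = ‖x‖ ^ 2 - ‖P x‖ ^ 2 := by
  have h := norm_add_sq_eq_norm_sq_add_norm_sq_of_inner_eq_zero (𝕜 := 𝕜) _ _
    (hP.inner_sub_apply x x)
  rw [add_sub_cancel] at h
  linarith

theorem norm_apply_le (hP : IsStarProjection P) (x : H) : ‖P x‖ ≤ ‖x‖ := by
  have h := hP.norm_sub_sq x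
  exact le_of_sq_le_sq (by nlinarith [sq_nonneg ‖x - P x‖]) (norm_nonneg _)

end IsStarProjection

open ContinuousLinearMap in
/-- The negative spectral projection of a bounded self-adjoint operator `S`: there are a positive
operator `M` (namely `|S|`) and an orthogonal projection `P` whose range contains the kernel of
`S`, such that `S = -M` on the range of `P` and `S = M` on its orthogonal complement. Both lie in
the bicommutant of `S`; for `P` only the self-adjoint part of the commutant is recorded. -/
theorem IsSelfAdjoint.exists_negative_projection {S : H →L[𝕜] H} (hS : IsSelfAdjoint S) :
    ∃ M P : H →L[𝕜] H, M.IsPositive ∧ IsStarProjection P ∧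
      (∀ Z, Commute Z S → Commute Z M) ∧ (∀ Z, IsSelfAdjoint Z → Commute Z S → Commute Z P) ∧
      (∀ x, S (P x) = -M (P x)) ∧ (∀ x, S (x - P x) = M (x - P x)) ∧
      ∀ x, S x = 0 → P x = x := by
  have hpos : (S * S).IsPositive := by
    have := isPositive_adjoint_comp_self S
    rwa [hS.adjoint_eq] at this
  obtain ⟨M, hM, hMM, hMc⟩ := hpos.exists_sqrt
  have hMc' : ∀ Z, Commute Z S → Commute Z M := fun Z hZ => hMc Z (hZ.mul_right hZ)
  have hSM : S * M = M * S := (hMc' S (Commute.refl S)).eq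
  let K : Submodule 𝕜 H := LinearMap.ker ((M + S : H →L[𝕜] H) : H →ₗ[𝕜] H)
  have : CompleteSpace K := (isClosed_ker (M + S)).completeSpace_coe
  have hK : ∀ x, x ∈ K ↔ M x + S x = 0 := fun x => by simp [K]
  have hP : IsStarProjection K.starProjection := isStarProjection_starProjection
  have hPK : ∀ x, K.starProjection x ∈ K := fun x => K.starProjection_apply_mem x
  have hKP : ∀ x ∈ K, K.starProjection x = x := fun x hx => K.starProjection_eq_self_iff.2 hx
  have hPc : ∀ Z, IsSelfAdjoint Z → Commute Z S → Commute Z K.starProjection := by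
    intro Z hZ hZS
    have hinv : ∀ x ∈ K, Z x ∈ K := fun x hx => by
      rw [hK] at hx ⊢
      rw [← hZS.operator_apply, ← (hMc' Z hZS).operator_apply, ← map_add, hx, map_zero]
    have h1 : K.starProjection * (Z * K.starProjection) = Z * K.starProjection := by
      ext x
      exact hKP _ (hinv _ (hPK x))
    have h2 := congrArg star h1
    simp only [star_mul, hP.isSelfAdjoint.star_eq, hZ.star_eq] at h2
    rw [Commute, SemiconjBy, ← h1, ← h2, mul_assoc]
  refine ⟨M, K.starProjection, hM, hP, hMc', hPc, fun x => ?_, fun x => ?_, fun x hx => ?_⟩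
  · exact eq_neg_of_add_eq_zero_right ((hK _).1 (hPK x))
  · have hran : ∀ x, M x - S x ∈ K := fun x => by
      have h1 : M (M x) = S (S x) := DFunLike.congr_fun hMM x
      have h2 : S (M x) = M (S x) := DFunLike.congr_fun hSM x
      rw [hK, map_sub, map_sub, h1, h2]
      abel
    have hcM : Commute M K.starProjection := hPc M hM.isSelfAdjoint (hMc' S (Commute.refl S)).symm
    have hcS : Commute S K.starProjection := hPc S hS (Commute.refl S)
    have h3 := hKP _ (hran x)
    rw [map_sub, ← hcM.operator_apply, ← hcS.operator_apply] at h3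
    rw [map_sub, map_sub, eq_comm, ← sub_eq_zero]
    rw [eq_comm, ← sub_eq_zero] at h3
    rw [← h3]
    abel
  · apply hKP
    rw [hK]
    have h1 : M (M x) = 0 := by rw [show M (M x) = S (S x) from DFunLike.congr_fun hMM x, hx,
      map_zero]
    have h2 : ‖M x‖ ^ 2 = 0 := by
      rw [← inner_self_eq_norm_sq (𝕜 := 𝕜), ← hM.inner_left_eq_inner_right, h1, inner_zero_left,
        map_zero]
    rw [show M x = 0 by simpa using h2, hx, add_zero]

end StarProjection

/-! ### Integrals from estimates on small intervals -/

/-- If the increments of `F` over small intervals agree with `g` times the measure up to an error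
of second order, then they are integrals of `g`. By bisection, an error which is additive in the
interval and at most `K * (t - s) * ν (s, t]` is also at most half of this bound, hence zero. -/
theorem sub_eq_setIntegral_of_abs_sub_le {ν : Measure ℝ} [IsFiniteMeasure ν] {F g : ℝ → ℝ}
    (hg : Continuous g) {a b K : ℝ} (hab : a ≤ b)
    (hF : ∀ s t, a ≤ s → s ≤ t → t ≤ b →
      |F t - F s - g s * ν.real (Set.Ioc s t)| ≤ K * (t - s) * ν.real (Set.Ioc s t))
    (hgK : ∀ s t, a ≤ s → s ≤ t → t ≤ b → |g t - g s| ≤ K * (t - s)) :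
    F b - F a = ∫ t in Set.Ioc a b, g t ∂ν := by
  have hint : ∀ s t, IntegrableOn g (Set.Ioc s t) ν := fun s t =>
    (hg.continuousOn.integrableOn_Icc (a := s) (b := t)).mono_set Set.Ioc_subset_Icc_self
  have hfin : ∀ s t, ν (Set.Ioc s t) ≠ ⊤ := fun s t => measure_ne_top _ _
  have key : ∀ n : ℕ, ∀ s t, a ≤ s → s ≤ t → t ≤ b →
      |F t - F s - ∫ u in Set.Ioc s t, g u ∂ν| ≤
        2 * K * (t - s) / 2 ^ n * ν.real (Set.Ioc s t) := by
    intro n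
    induction n with
    | zero =>
      intro s t has hst htb
      have h1 := hF s t has hst htb
      have h2 : |g s * ν.real (Set.Ioc s t) - ∫ u in Set.Ioc s t, g u ∂ν| ≤
          K * (t - s) * ν.real (Set.Ioc s t) := by
        have h3 : g s * ν.real (Set.Ioc s t) = ∫ u in Set.Ioc s t, g s ∂ν := by
          rw [setIntegral_const, smul_eq_mul, mul_comm]
        rw [h3, ← integral_sub (integrable_const _) (hint s t), ← Real.norm_eq_abs]
        refine norm_setIntegral_le_of_norm_le_const (lt_top_iff_ne_top.2 (hfin s t)) fun u hu => ?_
        have hK : 0 ≤ K := by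
          by_contra hK
          have := (abs_nonneg _).trans (hgK s u has hu.1.le (hu.2.trans htb))
          nlinarith [hu.1]
        rw [Real.norm_eq_abs, abs_sub_comm]
        refine (hgK s u has hu.1.le (hu.2.trans htb)).trans ?_
        gcongr
        exact hu.2
      have h3 := abs_add_le (F t - F s - g s * ν.real (Set.Ioc s t))
        (g s * ν.real (Set.Ioc s t) - ∫ u in Set.Ioc s t, g u ∂ν)
      rw [sub_add_sub_cancel] at h3
      linarith
    | succ n ih =>
      intro s t has hst htb
      set m := (s + t) / 2 with hm
      have hsm : s ≤ m := by linarith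
      have hmt : m ≤ t := by linarith
      have h1 := ih s m has hsm (hmt.trans htb)
      have h2 := ih m t (has.trans hsm) hmt htb
      have hdisj : Disjoint (Set.Ioc s m) (Set.Ioc m t) := Set.Ioc_disjoint_Ioc_of_le le_rfl
      rw [← Set.Ioc_union_Ioc_eq_Ioc hsm hmt, setIntegral_union hdisj measurableSet_Ioc (hint s m)
        (hint m t), measureReal_union hdisj measurableSet_Ioc (hfin _ _) (hfin _ _)]
      have h3 := abs_add_le (F m - F s - ∫ u in Set.Ioc s m, g u ∂ν)
        (F t - F m - ∫ u in Set.Ioc m t, g u ∂ν)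
      have h4 : F m - F s - (∫ u in Set.Ioc s m, g u ∂ν) + (F t - F m - ∫ u in Set.Ioc m t, g u ∂ν)
          = F t - F s - ((∫ u in Set.Ioc s m, g u ∂ν) + ∫ u in Set.Ioc m t, g u ∂ν) := by ring
      rw [h4] at h3
      have e1 : 2 * K * (m - s) / 2 ^ n = 2 * K * (t - s) / 2 ^ (n + 1) := by
        rw [hm, pow_succ]; field_simp; ring
      have e2 : 2 * K * (t - m) / 2 ^ n = 2 * K * (t - s) / 2 ^ (n + 1) := by
        rw [hm, pow_succ]; field_simp; ring
      rw [e1] at h1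
      rw [e2] at h2
      linarith
  have hlim : Tendsto (fun n : ℕ => 2 * K * (b - a) / 2 ^ n * ν.real (Set.Ioc a b)) atTop
      (𝓝 0) := by
    have := ((tendsto_pow_atTop_nhds_zero_of_lt_one (r := (2⁻¹ : ℝ)) (by norm_num)
      (by norm_num)).const_mul (2 * K * (b - a))).mul_const (ν.real (Set.Ioc a b))
    simpa [div_eq_mul_inv] using this
  have h := ge_of_tendsto' hlim fun n => key n a b le_rfl hab le_rfl
  exact sub_eq_zero.1 (abs_nonpos_iff.1 h)

/-! ### The Lebesgue-Stieltjes measures of a spectral family -/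

namespace SpectralFamily

variable {𝕜 H : Type*} [RCLike 𝕜] [NormedAddCommGroup H] [InnerProductSpace 𝕜 H]
  [CompleteSpace H] (E : SpectralFamily 𝕜 H)

theorem norm_proj_mono (x : H) {s t : ℝ} (hst : s ≤ t) : ‖E.proj s x‖ ≤ ‖E.proj t x‖ := by
  have h := ((ContinuousLinearMap.le_def _ _).1 (E.mono s t hst)).re_inner_nonneg_left x
  rw [sub_apply, inner_sub_left, map_sub, (E.isStarProjection t).re_inner_self,
    (E.isStarProjection s).re_inner_self] at h
  exact le_of_sq_le_sq (by linarith) (norm_nonneg _)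

theorem proj_proj_of_le {s t : ℝ} (hst : s ≤ t) (x : H) : E.proj s (E.proj t x) = E.proj s x := by
  have h := E.norm_proj_mono (x - E.proj t x) hst
  rw [map_sub (E.proj t), (E.isStarProjection t).apply_apply, sub_self, norm_zero,
    norm_le_zero_iff, map_sub, sub_eq_zero] at h
  exact h.symm

theorem proj_proj_of_ge {s t : ℝ} (hst : s ≤ t) (x : H) : E.proj t (E.proj s x) = E.proj s x := by
  refine ext_inner_right 𝕜 fun y => ?_
  rw [(E.isStarProjection t).inner_left, (E.isStarProjection s).inner_left, E.proj_proj_of_le hst,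
    (E.isStarProjection s).inner_left]

theorem proj_proj (s t : ℝ) (x : H) : E.proj s (E.proj t x) = E.proj (min s t) x := by
  rcases le_total s t with h | h
  · rw [min_eq_left h, E.proj_proj_of_le h]
  · rw [min_eq_right h, E.proj_proj_of_ge h]

theorem isStarProjection_sub {s t : ℝ} (hst : s ≤ t) :
    IsStarProjection (E.proj t - E.proj s) :=
  (E.isStarProjection s).sub_of_mul_eq_left (E.isStarProjection t)
    (ContinuousLinearMap.ext (E.proj_proj_of_le hst))

theorem stieltjes_apply (x : H) (t : ℝ) : E.stieltjes x t = ‖E.proj t x‖ ^ 2 :=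
  (E.isStarProjection t).re_inner_self x

theorem tendsto_stieltjes_atBot (x : H) : Tendsto (E.stieltjes x) atBot (𝓝 0) := by
  have h := (E.tendsto_atBot x).norm.pow 2
  rw [norm_zero, zero_pow two_ne_zero] at h
  exact h.congr fun t => (E.stieltjes_apply x t).symm

theorem tendsto_stieltjes_atTop (x : H) : Tendsto (E.stieltjes x) atTop (𝓝 (‖x‖ ^ 2)) :=
  ((E.tendsto_atTop x).norm.pow 2).congr fun t => (E.stieltjes_apply x t).symm

theorem measure_Iic (x : H) (t : ℝ) :
    E.measure x (Set.Iic t) = ENNReal.ofReal (‖E.proj t x‖ ^ 2) := by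
  rw [measure, (E.stieltjes x).measure_Iic (E.tendsto_stieltjes_atBot x), sub_zero,
    stieltjes_apply]

theorem measure_univ (x : H) : E.measure x Set.univ = ENNReal.ofReal (‖x‖ ^ 2) := by
  rw [measure, (E.stieltjes x).measure_univ (E.tendsto_stieltjes_atBot x)
    (E.tendsto_stieltjes_atTop x), sub_zero]

instance (x : H) : IsFiniteMeasure (E.measure x) :=
  ⟨by rw [measure_univ]; exact ENNReal.ofReal_lt_top⟩

theorem measureReal_univ (x : H) : (E.measure x).real Set.univ = ‖x‖ ^ 2 := by
  rw [measureReal_def, measure_univ, ENNReal.toReal_ofReal (sq_nonneg _)]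

theorem norm_sub_proj_sq (x : H) {s t : ℝ} (hst : s ≤ t) :
    ‖E.proj t x - E.proj s x‖ ^ 2 = ‖E.proj t x‖ ^ 2 - ‖E.proj s x‖ ^ 2 := by
  rw [← E.proj_proj_of_le hst x, (E.isStarProjection s).norm_sub_sq]

theorem measureReal_Ioc (x : H) {s t : ℝ} (hst : s ≤ t) :
    (E.measure x).real (Set.Ioc s t) = ‖E.proj t x - E.proj s x‖ ^ 2 := by
  rw [measureReal_def, measure, StieltjesFunction.measure_Ioc, stieltjes_apply, stieltjes_apply,
    ← E.norm_sub_proj_sq x hst, ENNReal.toReal_ofReal (sq_nonneg _)]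

theorem measure_proj (c : ℝ) (x : H) :
    E.measure (E.proj c x) = (E.measure x).restrict (Set.Iic c) := by
  refine Measure.ext_of_Iic _ _ fun t => ?_
  rw [Measure.restrict_apply measurableSet_Iic, Set.Iic_inter_Iic, measure_Iic, measure_Iic,
    E.proj_proj]

theorem measure_add {x y : H} (h : ∀ t, inner 𝕜 (E.proj t x) y = 0) :
    E.measure (x + y) = E.measure x + E.measure y := by
  refine Measure.ext_of_Iic _ _ fun t => ?_
  rw [Measure.add_apply, measure_Iic, measure_Iic, measure_Iic, ← ENNReal.ofReal_add (sq_nonneg _)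
    (sq_nonneg _), map_add, sq, sq, sq,
    norm_add_sq_eq_norm_sq_add_norm_sq_of_inner_eq_zero (𝕜 := 𝕜)]
  rw [(E.isStarProjection t).inner_left, (E.isStarProjection t).apply_apply,
    ← (E.isStarProjection t).inner_left, h]

theorem inner_proj_proj_sub (c t : ℝ) (x y : H) :
    inner 𝕜 (E.proj t (E.proj c x)) (y - E.proj c y) = 0 := by
  rw [E.proj_proj, min_comm, ← E.proj_proj, (E.isStarProjection c).inner_sub_apply]

theorem measure_sub_proj (c : ℝ) (x : H) :
    E.measure (x - E.proj c x) = (E.measure x).restrict (Set.Ioi c) := by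
  have h := E.measure_add (fun t => E.inner_proj_proj_sub c t x x)
  have h2 := Measure.restrict_add_restrict_compl (μ := E.measure x) (measurableSet_Iic (a := c))
  rw [add_sub_cancel, measure_proj] at h
  rw [Set.compl_Iic] at h2
  refine Measure.ext_of_Iic _ _ fun t => ?_
  have h3 := congrArg (fun ν : Measure ℝ => ν (Set.Iic t)) (h.symm.trans h2.symm)
  simp only [Measure.add_apply] at h3
  exact (ENNReal.add_right_inj (measure_ne_top _ _)).1 h3

theorem integrable_id_of_integrable_sq {ν : Measure ℝ} [IsFiniteMeasure ν]
    (h : Integrable (fun t : ℝ => t ^ 2) ν) : Integrable (fun t : ℝ => t) ν := by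
  refine ((integrable_const (1 : ℝ)).add h).mono' measurable_id.aestronglyMeasurable
    (.of_forall fun t => ?_)
  rw [Real.norm_eq_abs, Pi.add_apply]
  exact abs_le.2 ⟨by nlinarith, by nlinarith⟩

end SpectralFamily

/-! ### The graph of a self-adjoint operator -/

namespace IsSelfAdjoint

variable {𝕜 H : Type*} [RCLike 𝕜] [NormedAddCommGroup H] [InnerProductSpace 𝕜 H]
  [CompleteSpace H] {A : H →ₗ.[𝕜] H}

theorem inner_graph (hA : IsSelfAdjoint A) {x y u v : H} (hx : (x, y) ∈ A.graph)
    (hu : (u, v) ∈ A.graph) : inner 𝕜 y u = inner 𝕜 x v := by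
  have h := LinearPMap.adjoint_graph_eq_graph_adjoint hA.dense_domain
  rw [LinearPMap.isSelfAdjoint_def.1 hA] at h
  rw [h, Submodule.mem_adjoint_iff] at hu
  exact sub_eq_zero.1 (hu x y hx)

/-- The graph of a self-adjoint operator contains the limits of sequences in the domain along which
the operator stays bounded. -/
theorem exists_mem_graph_of_tendsto (hA : IsSelfAdjoint A) {x : H} {u v : ℕ → H} {m : ℝ} {k : ℕ → ℝ}
    {K : ℝ} (hu : Tendsto u atTop (𝓝 x)) (huv : ∀ n, (u n, v n) ∈ A.graph)
    (hk : ∀ n, ‖v n - (m : 𝕜) • u n‖ ≤ k n) (hkK : Tendsto k atTop (𝓝 K)) :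
    ∃ y, (x, y) ∈ A.graph ∧ ‖y - (m : 𝕜) • x‖ ≤ K := by
  have hsub : ∀ {x y a b : H}, (x, y) ∈ A.graph → (a, b) ∈ A.graph →
      inner 𝕜 (y - (m : 𝕜) • x) a = inner 𝕜 x (b - (m : 𝕜) • a) := by
    intro x y a b hx ha
    rw [inner_sub_left, inner_sub_right, hA.inner_graph hx ha, inner_smul_left, inner_smul_right,
      RCLike.conj_ofReal]
  have hbound : ∀ a b, (a, b) ∈ A.graph → ‖inner 𝕜 x (b - (m : 𝕜) • a)‖ ≤ K * ‖a‖ := by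
    intro a b hab
    refine le_of_tendsto_of_tendsto' (hu.inner tendsto_const_nhds).norm (hkK.mul_const ‖a‖)
      fun n => ?_
    rw [← hsub (huv n) hab]
    exact (norm_inner_le_norm _ _).trans (mul_le_mul_of_nonneg_right (hk n) (norm_nonneg _))
  have hdom : x ∈ A.domain := by
    rw [← LinearPMap.isSelfAdjoint_def.1 hA, LinearPMap.mem_adjoint_domain_iff]
    refine AddMonoidHomClass.continuous_of_bound _ (K + |m| * ‖x‖) fun a => ?_
    have h1 := hbound a (A a) (A.mem_graph a)
    rw [inner_sub_right] at h1
    have h2 : ‖inner 𝕜 x ((m : 𝕜) • (a : H))‖ ≤ |m| * ‖x‖ * ‖(a : H)‖ := by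
      rw [inner_smul_right, norm_mul, RCLike.norm_ofReal, mul_assoc]
      exact mul_le_mul_of_nonneg_left (norm_inner_le_norm _ _) (abs_nonneg _)
    have h3 := norm_sub_norm_le (inner 𝕜 x (A a)) (inner 𝕜 x ((m : 𝕜) • (a : H)))
    change ‖inner 𝕜 x (A a)‖ ≤ _ * ‖(a : H)‖
    linarith
  refine ⟨A ⟨x, hdom⟩, A.mem_graph ⟨x, hdom⟩, ?_⟩
  set w := A ⟨x, hdom⟩ - (m : 𝕜) • x with hw
  have hclosed : IsClosed {a : H | ‖inner 𝕜 w a‖ ≤ K * ‖a‖} :=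
    isClosed_le (by fun_prop) (by fun_prop)
  have hall : ∀ a : H, ‖inner 𝕜 w a‖ ≤ K * ‖a‖ := fun a => by
    refine hclosed.closure_subset_iff.2 (fun a ha => ?_) (hA.dense_domain a)
    have h1 := hbound a (A ⟨a, ha⟩) (A.mem_graph ⟨a, ha⟩)
    rwa [← hsub (A.mem_graph ⟨x, hdom⟩) (A.mem_graph ⟨a, ha⟩)] at h1
  have h1 := hall w
  rw [inner_self_eq_norm_sq_to_K, norm_pow, RCLike.norm_ofReal, abs_norm] at h1
  rcases (norm_nonneg w).eq_or_lt' with h0 | h0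
  · rw [h0]
    exact ge_of_tendsto' hkK fun n => (norm_nonneg _).trans (hk n)
  · nlinarith

end IsSelfAdjoint

/-! ### The bounded operators `(1 + A²)⁻¹` and `A (1 + A²)⁻¹` -/

namespace LinearPMap

variable {𝕜 H : Type*} [RCLike 𝕜] [NormedAddCommGroup H] [InnerProductSpace 𝕜 H]

/-- `C = (1 + A²)⁻¹` and `B = A (1 + A²)⁻¹`, expressed through the graph of `A`: for every `z` the
vector `x = C z` satisfies `A x = B z` and `A (A x) = z - x`. -/
structure IsSqResolvent (A : H →ₗ.[𝕜] H) (C B : H →L[𝕜] H) : Prop where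
  mem_graph : ∀ z, (C z, B z) ∈ A.graph
  mem_graph_sub : ∀ z, (B z, z - C z) ∈ A.graph

variable [CompleteSpace H] {A : H →ₗ.[𝕜] H}

theorem norm_sq_add_norm_sq_of_mem_graph (hA : IsSelfAdjoint A) {x y z : H}
    (h1 : (x, y) ∈ A.graph) (h2 : (y, z - x) ∈ A.graph) :
    ‖x‖ ^ 2 + ‖y‖ ^ 2 = RCLike.re (inner 𝕜 x z) := by
  have h := congrArg RCLike.re (hA.inner_graph h1 h2)
  rw [inner_sub_right, _root_.map_sub, inner_self_eq_norm_sq, inner_self_eq_norm_sq] at h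
  linarith

/-- The equation `(1 + A²) x = z` has at most one solution. -/
theorem eq_of_mem_graph (hA : IsSelfAdjoint A) {x y x' y' z : H}
    (h1 : (x, y) ∈ A.graph) (h2 : (y, z - x) ∈ A.graph)
    (h1' : (x', y') ∈ A.graph) (h2' : (y', z - x') ∈ A.graph) : x = x' ∧ y = y' := by
  have h3 : (x - x', y - y') ∈ A.graph := A.graph.sub_mem h1 h1'
  have h4 : (y - y', (0 : H) - (x - x')) ∈ A.graph := by
    convert A.graph.sub_mem h2 h2' using 1
    ext <;> simp
  have h := norm_sq_add_norm_sq_of_mem_graph hA h3 h4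
  rw [inner_zero_right, _root_.map_zero] at h
  have hx : ‖x - x'‖ ^ 2 = 0 := by nlinarith [sq_nonneg ‖x - x'‖, sq_nonneg ‖y - y'‖]
  have hy : ‖y - y'‖ ^ 2 = 0 := by nlinarith [sq_nonneg ‖x - x'‖, sq_nonneg ‖y - y'‖]
  exact ⟨sub_eq_zero.1 (by simpa using hx), sub_eq_zero.1 (by simpa using hy)⟩

/-- The equation `(1 + A²) x = z` has a solution, obtained by projecting `(z, 0)` orthogonally
onto the graph of `A`. -/
theorem exists_mem_graph (hA : IsSelfAdjoint A) (z : H) :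
    ∃ x y, (x, y) ∈ A.graph ∧ (y, z - x) ∈ A.graph := by
  let K : Submodule 𝕜 (WithLp 2 (H × H)) :=
    A.graph.comap (WithLp.linearEquiv 2 𝕜 (H × H)).toLinearMap
  have hcl : _root_.IsClosed (K : Set (WithLp 2 (H × H))) :=
    hA.isClosed.preimage (WithLp.prod_continuous_ofLp 2 H H)
  have : CompleteSpace K := hcl.completeSpace_coe
  let w : WithLp 2 (H × H) := WithLp.toLp 2 (z, 0)
  let p := K.starProjection w
  have hp : (p.fst, p.snd) ∈ A.graph := K.starProjection_apply_mem w
  refine ⟨p.fst, p.snd, hp, ?_⟩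
  have h := LinearPMap.adjoint_graph_eq_graph_adjoint hA.dense_domain
  rw [LinearPMap.isSelfAdjoint_def.1 hA] at h
  rw [h, Submodule.mem_adjoint_iff]
  intro a b hab
  have hq := K.inner_right_of_mem_orthogonal (u := WithLp.toLp 2 (a, b)) hab
    (K.sub_starProjection_mem_orthogonal w)
  rw [WithLp.prod_inner_apply] at hq
  change inner 𝕜 a (z - p.fst) + inner 𝕜 b (0 - p.snd) = 0 at hq
  rw [zero_sub, inner_neg_right] at hq
  dsimp only
  rw [sub_eq_zero, eq_comm]
  exact sub_eq_zero.1 (by rwa [sub_eq_add_neg])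

/-- The solution operators of `(1 + A²) x = z` are contractions because
`‖x‖² + ‖A x‖² = re ⟪x, z⟫`. -/
theorem exists_isSqResolvent (hA : IsSelfAdjoint A) :
    ∃ C B : H →L[𝕜] H, A.IsSqResolvent C B := by
  choose f g hfg hgf using exists_mem_graph hA
  have hadd : ∀ z w, f (z + w) = f z + f w ∧ g (z + w) = g z + g w := fun z w => by
    refine eq_of_mem_graph hA (hfg _) (hgf _) (A.graph.add_mem (hfg z) (hfg w)) ?_
    convert A.graph.add_mem (hgf z) (hgf w) using 1
    ext <;> simp [add_sub_add_comm]
  have hsmul : ∀ (c : 𝕜) z, f (c • z) = c • f z ∧ g (c • z) = c • g z := fun c z => by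
    refine eq_of_mem_graph hA (hfg _) (hgf _) (A.graph.smul_mem c (hfg z)) ?_
    convert A.graph.smul_mem c (hgf z) using 1
    ext <;> simp [smul_sub]
  have hle : ∀ z, ‖f z‖ ≤ ‖z‖ ∧ ‖g z‖ ≤ ‖z‖ := fun z => by
    have h1 := norm_sq_add_norm_sq_of_mem_graph hA (hfg z) (hgf z)
    have h2 := re_inner_le_norm (𝕜 := 𝕜) (f z) z
    have h3 : ‖f z‖ ≤ ‖z‖ := by
      by_contra! h3
      nlinarith [sq_nonneg ‖g z‖, norm_nonneg z]
    refine ⟨h3, le_of_sq_le_sq ?_ (norm_nonneg _)⟩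
    nlinarith [norm_nonneg z, norm_nonneg (f z)]
  let F : H →ₗ[𝕜] H := ⟨⟨f, fun z w => (hadd z w).1⟩, fun c z => (hsmul c z).1⟩
  let G : H →ₗ[𝕜] H := ⟨⟨g, fun z w => (hadd z w).2⟩, fun c z => (hsmul c z).2⟩
  exact ⟨F.mkContinuous 1 fun z => by rw [one_mul]; exact (hle z).1,
    G.mkContinuous 1 fun z => by rw [one_mul]; exact (hle z).2, hfg, hgf⟩

namespace IsSqResolvent

variable {C B : H →L[𝕜] H} (h : A.IsSqResolvent C B) (hA : IsSelfAdjoint A)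
include h hA

theorem inner_left (z w : H) :
    inner 𝕜 (C z) w = inner 𝕜 (C z) (C w) + inner 𝕜 (B z) (B w) := by
  rw [hA.inner_graph (h.mem_graph z) (h.mem_graph_sub w), inner_sub_right, add_sub_cancel]

theorem inner_right (z w : H) :
    inner 𝕜 z (C w) = inner 𝕜 (C z) (C w) + inner 𝕜 (B z) (B w) := by
  rw [← hA.inner_graph (h.mem_graph_sub z) (h.mem_graph w), inner_sub_left, add_sub_cancel]

theorem isPositive : C.IsPositive := by
  rw [ContinuousLinearMap.isPositive_def]
  refine ⟨fun z w => (h.inner_left hA z w).trans (h.inner_right hA z w).symm, fun z => ?_⟩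
  rw [ContinuousLinearMap.reApplyInnerSelf_apply, h.inner_left hA, _root_.map_add,
    inner_self_eq_norm_sq,
    inner_self_eq_norm_sq]
  positivity

theorem isSelfAdjoint_right : IsSelfAdjoint B := by
  rw [ContinuousLinearMap.isSelfAdjoint_iff_isSymmetric]
  intro z w
  have h1 := hA.inner_graph (h.mem_graph z) (h.mem_graph w)
  have h2 := hA.inner_graph (h.mem_graph_sub z) (h.mem_graph_sub w)
  rw [inner_sub_left, inner_sub_right, h1] at h2
  exact (sub_left_inj.1 h2).symm

omit [CompleteSpace H] hA in
theorem eq_zero_of_apply_eq_zero {z : H} (hz : C z = 0) : z = 0 := by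
  have h1 := h.mem_graph z
  have h2 := h.mem_graph_sub z
  rw [hz] at h1 h2
  rw [A.graph_fst_eq_zero_snd h1 rfl, sub_zero] at h2
  exact A.graph_fst_eq_zero_snd h2 rfl

/-- `A (1 + A²)⁻¹ x = (1 + A²)⁻¹ A x` on the domain of `A`. -/
theorem apply_eq_of_mem_graph {x y : H} (hxy : (x, y) ∈ A.graph) : B x = C y :=
  (eq_of_mem_graph hA (h.mem_graph_sub x) (A.graph.sub_mem hxy (h.mem_graph x)) (h.mem_graph y)
    (h.mem_graph_sub y)).1

theorem commute : Commute B C := by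
  ext z
  exact h.apply_eq_of_mem_graph hA (h.mem_graph z)

theorem commute_of_forall_mem_graph {Z : H →L[𝕜] H}
    (hZ : ∀ x y, (x, y) ∈ A.graph → (Z x, Z y) ∈ A.graph) : Commute Z C ∧ Commute Z B := by
  have h1 : ∀ z, Z (C z) = C (Z z) ∧ Z (B z) = B (Z z) := fun z => by
    refine eq_of_mem_graph hA (hZ _ _ (h.mem_graph z)) ?_ (h.mem_graph _) (h.mem_graph_sub _)
    rw [← _root_.map_sub]
    exact hZ _ _ (h.mem_graph_sub z)
  exact ⟨ContinuousLinearMap.ext fun z => (h1 z).1, ContinuousLinearMap.ext fun z => (h1 z).2⟩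

theorem mem_graph_of_commute {Z : H →L[𝕜] H} (hC : Commute Z C) (hB : Commute Z B) {x y : H}
    (hxy : (x, y) ∈ A.graph) : (Z x, Z y) ∈ A.graph := by
  have h1 := h.apply_eq_of_mem_graph hA hxy
  -- `(x, y) = (C x, B x) + (B y, y - C y)`.
  have h2 : x - C x = B y := by
    have := h.mem_graph_sub x
    rw [h1] at this
    exact A.mem_graph_snd_inj this (h.mem_graph y) rfl
  convert A.graph.add_mem (h.mem_graph (Z x)) (h.mem_graph_sub (Z y)) using 1
  rw [Prod.mk_add_mk, ← hC.operator_apply, ← hB.operator_apply, ← hB.operator_apply,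
    ← hC.operator_apply, ← _root_.map_add, ← h2, h1, ← _root_.map_sub, ← _root_.map_add,
    add_sub_cancel, add_sub_cancel]

end IsSqResolvent

end LinearPMap

/-! ### Strong limits of monotone families of projections -/

section MonotoneProjections

variable {𝕜 H : Type*} [RCLike 𝕜] [NormedAddCommGroup H] [InnerProductSpace 𝕜 H]
  [CompleteSpace H] {P : ℝ → H →L[𝕜] H}

/-- Strong convergence follows from convergence of `‖P(t) x‖²`, since
`‖P(t) x - P(s) x‖² = ‖P(t) x‖² - ‖P(s) x‖²` for `s ≤ t`. -/
theorem exists_tendsto_projections (hP : ∀ t, IsStarProjection (P t))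
    (hmono : ∀ s t, s ≤ t → ∀ x, P s (P t x) = P s x) {l : Filter ℝ} [l.NeBot] {x : H} {c : ℝ}
    (hc : Tendsto (fun t => ‖P t x‖ ^ 2) l (𝓝 c)) : ∃ y, Tendsto (fun t => P t x) l (𝓝 y) := by
  refine cauchy_map_iff_exists_tendsto.1 (Metric.cauchy_iff.2 ⟨inferInstance, fun ε hε => ?_⟩)
  obtain ⟨T, hT, hTε⟩ := (Metric.cauchy_iff.1 hc.cauchy_map).2 (ε ^ 2) (by positivity)
  have hd : ∀ s t, s ≤ t → dist (P s x) (P t x) ^ 2 = ‖P t x‖ ^ 2 - ‖P s x‖ ^ 2 := fun s t hst => by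
    have := (hP s).norm_sub_sq (P t x)
    rwa [hmono s t hst, ← dist_eq_norm, dist_comm] at this
  refine ⟨(fun t => P t x) '' ((fun t => ‖P t x‖ ^ 2) ⁻¹' T), image_mem_map hT, ?_⟩
  have key : ∀ s t, s ≤ t → ‖P s x‖ ^ 2 ∈ T → ‖P t x‖ ^ 2 ∈ T → dist (P s x) (P t x) < ε := by
    intro s t hst hs ht
    have h1 := (le_abs_self _).trans_lt (hTε _ ht _ hs)
    rw [← hd s t hst] at h1
    exact lt_of_pow_lt_pow_left₀ 2 hε.le h1
  rintro _ ⟨s, hs, rfl⟩ _ ⟨t, ht, rfl⟩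
  rcases le_total s t with hst | hst
  · exact key s t hst hs ht
  · rw [dist_comm]
    exact key t s hst ht hs

end MonotoneProjections

/-! ### The spectral family of a self-adjoint operator -/

namespace LinearPMap.IsSqResolvent

variable {𝕜 H : Type*} [RCLike 𝕜] [NormedAddCommGroup H] [InnerProductSpace 𝕜 H]
  [CompleteSpace H] {A : H →ₗ.[𝕜] H} {C B : H →L[𝕜] H}

/-- `E(t)` is the negative spectral projection of the bounded operator
`B - t C = (A - t) (1 + A²)⁻¹`, which contains the kernel of that operator in its range; this
choice makes `E` continuous from the right. The last clause says that `A - (a + b) / 2` is bounded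
by `(b - a) / 2` on the range of `(E(b) - E(a)) C`. -/
theorem exists_spectralFamily (h : A.IsSqResolvent C B) (hA : IsSelfAdjoint A) :
    ∃ E : SpectralFamily 𝕜 H,
      (∀ t Z, IsSelfAdjoint Z → Commute Z C → Commute Z B → Commute Z (E.proj t)) ∧
      ∀ a b, a ≤ b → ∀ z, E.proj a z = 0 → E.proj b z = z →
        ‖B z - (((a + b) / 2 : ℝ) : 𝕜) • C z‖ ≤ (b - a) / 2 * ‖C z‖ := by
  have hC := h.isPositive hA
  have hB := h.isSelfAdjoint_right hA
  have hBC := h.commute hA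
  let S : ℝ → H →L[𝕜] H := fun t => B - (t : 𝕜) • C
  have hS : ∀ t, IsSelfAdjoint (S t) := fun t =>
    hB.sub (.smul (RCLike.conj_ofReal t) hC.isSelfAdjoint)
  have hSapp : ∀ t z, S t z = B z - (t : 𝕜) • C z := fun t z => rfl
  have hZS : ∀ {Z} t, Commute Z C → Commute Z B → Commute Z (S t) := fun t h1 h2 =>
    h2.sub_right (h1.smul_right _)
  have hSS : ∀ s t, Commute (S s) (S t) := fun s t =>
    hZS t (hBC.sub_left ((Commute.refl C).smul_left _))
      ((Commute.refl B).sub_left (hBC.symm.smul_left _))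
  choose M P hM hP hMc hPc hneg hpos hker using fun t => (hS t).exists_negative_projection
  have hre : ∀ t z, RCLike.re (inner 𝕜 (S t z) z) =
      RCLike.re (inner 𝕜 (B z) z) - t * RCLike.re (inner 𝕜 (C z) z) := fun t z => by
    rw [hSapp, inner_sub_left, inner_smul_left, RCLike.conj_ofReal, _root_.map_sub,
      RCLike.re_ofReal_mul]
  have hle : ∀ t z, P t z = z →
      RCLike.re (inner 𝕜 (B z) z) ≤ t * RCLike.re (inner 𝕜 (C z) z) := fun t z hz => by
    have h1 := hneg t z
    have h2 := (hM t).re_inner_nonneg_left z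
    rw [hz] at h1
    rw [← sub_nonpos, ← hre, h1, inner_neg_left, _root_.map_neg]
    linarith
  have hge' : ∀ t z, P t z = 0 → S t z = M t z := fun t z hz => by
    have h1 := hpos t z
    rwa [hz, sub_zero] at h1
  have hge : ∀ t z, P t z = 0 →
      t * RCLike.re (inner 𝕜 (C z) z) ≤ RCLike.re (inner 𝕜 (B z) z) := fun t z hz => by
    rw [← sub_nonneg, ← hre, hge' t z hz]
    exact (hM t).re_inner_nonneg_left z
  have hC0 : ∀ z, RCLike.re (inner 𝕜 (C z) z) ≤ 0 → z = 0 := fun z hz =>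
    h.eq_zero_of_apply_eq_zero (hC.apply_eq_zero hz)
  have hPP : ∀ s t, Commute (P s) (P t) := fun s t =>
    hPc t _ (hP s).isSelfAdjoint (hPc s _ (hS t) (hSS t s)).symm
  have hmono : ∀ s t, s ≤ t → ∀ x, P s (P t x) = P s x := by
    intro s t hst x
    rcases hst.eq_or_lt with rfl | hst
    · exact (hP s).apply_apply x
    have h1 : P s (P s x - P s (P t x)) = P s x - P s (P t x) := by
      rw [_root_.map_sub, (hP s).apply_apply, (hP s).apply_apply]
    have h2 : P t (P s x - P s (P t x)) = 0 := by
      rw [_root_.map_sub, (hPP s t).operator_apply, (hP t).apply_apply, sub_self]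
    have h3 := hle s _ h1
    have h4 := hge t _ h2
    have h5 := hC.re_inner_nonneg_left (P s x - P s (P t x))
    exact (sub_eq_zero.1 (hC0 _ (by nlinarith))).symm
  have hmono' : ∀ s t, s ≤ t → ∀ x, P t (P s x) = P s x := fun s t hst x => by
    rw [← (hPP s t).operator_apply, hmono s t hst]
  have hnorm : ∀ x, Monotone fun t => ‖P t x‖ ^ 2 := fun x s t hst => by
    have h1 := (hP s).norm_apply_le (P t x)
    rw [hmono s t hst] at h1
    exact pow_le_pow_left₀ (norm_nonneg _) h1 2
  have hright : ∀ t x, Tendsto (fun s => P s x) (𝓝[>] t) (𝓝 (P t x)) := by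
    intro t x
    obtain ⟨y, hy⟩ := exists_tendsto_projections hP hmono ((hnorm x).tendsto_nhdsGT t)
    have h1 : ∀ u, t < u → P u y = y := fun u hu => by
      refine tendsto_nhds_unique (((P u).continuous.tendsto y).comp hy) (hy.congr' ?_)
      filter_upwards [Ioo_mem_nhdsGT hu] with s hs
      exact (hmono' s u hs.2.le x).symm
    have h2 : P t y = P t x := by
      refine tendsto_nhds_unique (((P t).continuous.tendsto y).comp hy)
        (tendsto_const_nhds.congr' ?_)
      filter_upwards [self_mem_nhdsWithin] with s hs
      exact (hmono t s (le_of_lt hs) x).symm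
    -- The part of the limit orthogonal to the range of `P t` is annihilated by `S t`.
    have h3 : P t (y - P t y) = 0 := by rw [_root_.map_sub, (hP t).apply_apply, sub_self]
    have h4 : ∀ u, t < u → P u (y - P t y) = y - P t y := fun u hu => by
      rw [_root_.map_sub, h1 u hu, hmono' t u hu.le]
    have h5 : RCLike.re (inner 𝕜 (B (y - P t y)) (y - P t y)) ≤
        t * RCLike.re (inner 𝕜 (C (y - P t y)) (y - P t y)) := by
      have h6 : Tendsto (fun u => u * RCLike.re (inner 𝕜 (C (y - P t y)) (y - P t y))) (𝓝[>] t)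
          (𝓝 (t * RCLike.re (inner 𝕜 (C (y - P t y)) (y - P t y)))) :=
        ((continuous_mul_const _).tendsto t).mono_left nhdsWithin_le_nhds
      refine ge_of_tendsto h6 ?_
      filter_upwards [self_mem_nhdsWithin] with u hu
      exact hle u _ (h4 u hu)
    have h6 : M t (y - P t y) = 0 := (hM t).apply_eq_zero (by
      rw [← hge' t _ h3, hre]
      linarith)
    have h7 := hker t _ ((hge' t _ h3).trans h6)
    rw [h3, eq_comm, sub_eq_zero, h2] at h7
    rwa [h7] at hy
  have hbot : ∀ x, Tendsto (fun t => P t x) atBot (𝓝 0) := by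
    intro x
    obtain ⟨y, hy⟩ := exists_tendsto_projections hP hmono
      (tendsto_atBot_ciInf (hnorm x) ⟨0, by rintro _ ⟨t, rfl⟩; positivity⟩)
    have h1 : ∀ u, P u y = y := fun u => by
      refine tendsto_nhds_unique (((P u).continuous.tendsto y).comp hy) (hy.congr' ?_)
      filter_upwards [eventually_le_atBot u] with s hs
      exact (hmono' s u hs x).symm
    have h2 : y = 0 := hC0 y (by
      by_contra! h3
      have h4 := hle ((RCLike.re (inner 𝕜 (B y) y) - 1) / RCLike.re (inner 𝕜 (C y) y)) y (h1 _)
      rw [div_mul_cancel₀ _ h3.ne'] at h4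
      linarith)
    rwa [h2] at hy
  have htop : ∀ x, Tendsto (fun t => P t x) atTop (𝓝 x) := by
    intro x
    obtain ⟨y, hy⟩ := exists_tendsto_projections hP hmono
      (tendsto_atTop_ciSup (hnorm x) ⟨‖x‖ ^ 2, by
        rintro _ ⟨t, rfl⟩
        exact pow_le_pow_left₀ (norm_nonneg _) ((hP t).norm_apply_le x) 2⟩)
    have h1 : ∀ u, P u (x - y) = 0 := fun u => by
      rw [_root_.map_sub, sub_eq_zero]
      refine tendsto_nhds_unique (tendsto_const_nhds.congr' ?_)
        (((P u).continuous.tendsto y).comp hy)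
      filter_upwards [eventually_ge_atTop u] with s hs
      exact (hmono u s hs x).symm
    have h2 : x - y = 0 := hC0 _ (by
      by_contra! h3
      have h4 := hge ((RCLike.re (inner 𝕜 (B (x - y)) (x - y)) + 1) /
        RCLike.re (inner 𝕜 (C (x - y)) (x - y))) _ (h1 _)
      rw [div_mul_cancel₀ _ h3.ne'] at h4
      linarith)
    rwa [← sub_eq_zero.1 h2] at hy
  refine ⟨⟨P, hP, fun s t hst => ?_, hright, hbot, htop⟩,
    fun t Z hZ h1 h2 => hPc t Z hZ (hZS t h1 h2), fun a b hab z hza hzb => ?_⟩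
  · rw [ContinuousLinearMap.le_def]
    exact .of_isStarProjection ((hP s).sub_of_mul_eq_left (hP t)
      (ContinuousLinearMap.ext (hmono s t hst)))
  · -- On the range of `P b - P a`, `S a` and `-(S b)` are commuting positive operators.
    have h1 : (M a * M b).IsPositive :=
      (hM a).mul_of_commute (hM b) (hMc b _ (hMc a _ (hSS b a)).symm)
    have h2 : S b z = -M b z := by simpa only [hzb] using hneg b z
    have h3 : P a (M b z) = 0 := by
      have h4 : Commute (M b) (P a) := hPc a _ (hM b).isSelfAdjoint (hMc b _ (hSS a b)).symm
      rw [← h4.operator_apply, hza, _root_.map_zero]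
    have h5 := h1.re_inner_nonneg_left z
    have h6 : (M a * M b) z = -S a (S b z) := by
      rw [h2, _root_.map_neg, neg_neg, hge' a _ h3]
      rfl
    rw [h6, inner_neg_left, show inner 𝕜 (S a (S b z)) z =
      inner 𝕜 (S b z) (S a z) from (hS a).isSymmetric _ _, hSapp, hSapp] at h5
    set u := B z - (((a + b) / 2 : ℝ) : 𝕜) • C z with hu
    have e1 : B z - (b : 𝕜) • C z = u - (((b - a) / 2 : ℝ) : 𝕜) • C z := by
      rw [hu, sub_sub, ← add_smul, ← RCLike.ofReal_add]
      congr 4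
      ring
    have e2 : B z - (a : 𝕜) • C z = u + (((b - a) / 2 : ℝ) : 𝕜) • C z := by
      rw [hu, sub_add, ← sub_smul, ← RCLike.ofReal_sub]
      congr 4
      ring
    rw [e1, e2, inner_sub_left, inner_add_right, inner_add_right] at h5
    simp only [_root_.map_neg, _root_.map_sub, _root_.map_add, inner_self_eq_norm_sq] at h5
    rw [inner_re_symm, norm_smul, RCLike.norm_ofReal, abs_of_nonneg (by linarith)] at h5
    refine le_of_sq_le_sq (by linarith) (by have := norm_nonneg (C z); nlinarith)

end LinearPMap.IsSqResolvent

/-! ### Representation of the operator by its spectral family -/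

namespace SpectralFamily

variable {𝕜 H : Type*} [RCLike 𝕜] [NormedAddCommGroup H] [InnerProductSpace 𝕜 H]
  [CompleteSpace H] {A : H →ₗ.[𝕜] H} {E : SpectralFamily 𝕜 H}

/-- If `A` commutes with `E` and is within `(b - a) / 2` of `(a + b) / 2` on the range of
`E(b) - E(a)`, for all `a ≤ b`, then the formulas for `‖A u‖²` and `⟪A u, u⟫` hold on
these ranges, with the integrals over `(a, b]`. With `y = A u`, the functions `t ↦ ‖E(t) y‖²` and
`t ↦ re ⟪E(t) y, u⟫` have the increments required by `sub_eq_setIntegral_of_abs_sub_le`. -/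
theorem exists_mem_graph_setIntegral
    (hcomm : ∀ t x y, (x, y) ∈ A.graph → (E.proj t x, E.proj t y) ∈ A.graph)
    (hslab : ∀ a b, a ≤ b → ∀ x, E.proj a x = 0 → E.proj b x = x →
      ∃ y, (x, y) ∈ A.graph ∧ ‖y - (((a + b) / 2 : ℝ) : 𝕜) • x‖ ≤ (b - a) / 2 * ‖x‖)
    (x : H) {a b : ℝ} (hab : a ≤ b) :
    ∃ y, (E.proj b x - E.proj a x, y) ∈ A.graph ∧
      ‖y‖ ^ 2 = ∫ t in Set.Ioc a b, t ^ 2 ∂(E.measure x) ∧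
      RCLike.re (inner 𝕜 y (E.proj b x - E.proj a x)) = ∫ t in Set.Ioc a b, t ∂(E.measure x) := by
  set u := E.proj b x - E.proj a x with hu
  have hua : E.proj a u = 0 := by
    rw [hu, map_sub, (E.isStarProjection a).apply_apply, E.proj_proj_of_le hab, sub_self]
  have hub : E.proj b u = u := by
    rw [hu, map_sub, (E.isStarProjection b).apply_apply, E.proj_proj_of_ge hab]
  obtain ⟨y, hy, -⟩ := hslab a b hab u hua hub
  have hya : E.proj a y = 0 := A.graph_fst_eq_zero_snd (hcomm a _ _ hy) hua
  have hyb : E.proj b y = y := A.mem_graph_snd_inj (hcomm b _ _ hy) hy hub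
  have key : ∀ s t, a ≤ s → s ≤ t → t ≤ b →
      ‖E.proj t y - E.proj s y - (s : 𝕜) • (E.proj t x - E.proj s x)‖ ≤
        (t - s) * ‖E.proj t x - E.proj s x‖ ∧ E.proj t u - E.proj s u = E.proj t x - E.proj s x := by
    intro s t has hst htb
    have hw : E.proj t u - E.proj s u = E.proj t x - E.proj s x := by
      rw [hu, map_sub, map_sub, E.proj_proj_of_le htb, E.proj_proj_of_le (hst.trans htb),
        E.proj_proj_of_ge has, E.proj_proj_of_ge (has.trans hst), sub_sub_sub_cancel_right]
    set w := E.proj t x - E.proj s x with hw'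
    have hwy : (w, E.proj t y - E.proj s y) ∈ A.graph := by
      rw [← hw]
      exact A.graph.sub_mem (hcomm t _ _ hy) (hcomm s _ _ hy)
    obtain ⟨y', hy', hle⟩ := hslab s t hst w
      (by rw [hw', map_sub, (E.isStarProjection s).apply_apply, E.proj_proj_of_le hst, sub_self])
      (by rw [hw', map_sub, (E.isStarProjection t).apply_apply, E.proj_proj_of_ge hst])
    rw [A.mem_graph_snd_inj hy' hwy rfl] at hle
    refine ⟨?_, hw⟩
    have e : E.proj t y - E.proj s y - (s : 𝕜) • w =
        (E.proj t y - E.proj s y - (((s + t) / 2 : ℝ) : 𝕜) • w) + (((t - s) / 2 : ℝ) : 𝕜) • w := by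
      rw [sub_add, ← sub_smul, ← RCLike.ofReal_sub]
      congr 3
      ring
    rw [e]
    refine (norm_add_le _ _).trans ?_
    rw [norm_smul, RCLike.norm_ofReal, abs_of_nonneg (by linarith)]
    linarith
  refine ⟨y, hy, ?_, ?_⟩
  · have h := sub_eq_setIntegral_of_abs_sub_le (ν := E.measure x) (F := fun t => ‖E.proj t y‖ ^ 2)
      (g := fun t => t ^ 2) (by fun_prop) (K := 2 * (|a| + |b|) + (b - a)) hab ?_ ?_
    · simpa only [hyb, hya, norm_zero, zero_pow two_ne_zero, sub_zero] using h
    · intro s t has hst htb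
      obtain ⟨h1, -⟩ := key s t has hst htb
      rw [E.measureReal_Ioc x hst, ← E.norm_sub_proj_sq y hst]
      set w := E.proj t x - E.proj s x
      set v := E.proj t y - E.proj s y
      set d := v - (s : 𝕜) • w with hd
      have hv : v = d + (s : 𝕜) • w := by rw [hd, sub_add_cancel]
      have h2 := norm_add_sq (𝕜 := 𝕜) d ((s : 𝕜) • w)
      rw [← hv, norm_smul, RCLike.norm_ofReal, mul_pow, sq_abs, inner_smul_right,
        RCLike.re_ofReal_mul] at h2
      have h3 : |RCLike.re (inner 𝕜 d w)| ≤ (t - s) * ‖w‖ ^ 2 :=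
        ((RCLike.abs_re_le_norm _).trans (norm_inner_le_norm d w)).trans
          (by nlinarith [norm_nonneg w])
      have h4 : ‖d‖ ^ 2 ≤ (b - a) * (t - s) * ‖w‖ ^ 2 := by
        have h5 := pow_le_pow_left₀ (norm_nonneg d) h1 2
        have h6 : (t - s) * ((t - s) * ‖w‖ ^ 2) ≤ (b - a) * ((t - s) * ‖w‖ ^ 2) :=
          mul_le_mul_of_nonneg_right (by linarith)
            (mul_nonneg (by linarith) (sq_nonneg _))
        linarith
      have hs : |s| ≤ |a| + |b| := abs_le.2 ⟨by
        linarith [neg_abs_le a, abs_nonneg b], by linarith [le_abs_self b, abs_nonneg a]⟩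
      have h7 : |s * RCLike.re (inner 𝕜 d w)| ≤ (|a| + |b|) * ((t - s) * ‖w‖ ^ 2) := by
        rw [abs_mul]
        exact mul_le_mul hs h3 (abs_nonneg _) (by positivity)
      have h8 := abs_le.1 h7
      rw [abs_le]
      constructor <;> nlinarith [sq_nonneg ‖d‖]
    · intro s t has hst htb
      rw [sq_sub_sq, abs_mul, abs_of_nonneg (a := t - s) (by linarith)]
      refine mul_le_mul_of_nonneg_right ?_ (by linarith)
      rw [abs_le]
      constructor <;> linarith [neg_abs_le a, abs_nonneg b, le_abs_self b, abs_nonneg a]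
  · have h := sub_eq_setIntegral_of_abs_sub_le (ν := E.measure x)
      (F := fun t => RCLike.re (inner 𝕜 (E.proj t y) u)) (g := fun t => t) (by fun_prop) (K := 1)
      hab ?_ ?_
    · simpa only [hyb, hya, inner_zero_left, map_zero, sub_zero] using h
    · intro s t has hst htb
      obtain ⟨h1, h2⟩ := key s t has hst htb
      rw [E.measureReal_Ioc x hst, ← map_sub, ← inner_sub_left]
      have h3 : E.proj t y - E.proj s y = (E.proj t - E.proj s) (E.proj t y - E.proj s y) :=
        ((E.isStarProjection_sub hst).apply_apply y).symm
      have h4 : inner 𝕜 (E.proj t y - E.proj s y) u =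
          inner 𝕜 (E.proj t y - E.proj s y) (E.proj t x - E.proj s x) := by
        rw [h3, (E.isStarProjection_sub hst).inner_left, ← h3, ← h2]
        rfl
      rw [h4]
      set w := E.proj t x - E.proj s x
      set v := E.proj t y - E.proj s y
      have h5 : RCLike.re (inner 𝕜 v w) - s * ‖w‖ ^ 2 =
          RCLike.re (inner 𝕜 (v - (s : 𝕜) • w) w) := by
        rw [inner_sub_left v, inner_smul_left, RCLike.conj_ofReal, map_sub, RCLike.re_ofReal_mul,
          inner_self_eq_norm_sq]
      rw [h5]
      refine ((RCLike.abs_re_le_norm _).trans (norm_inner_le_norm _ w)).trans ?_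
      nlinarith [norm_nonneg w]
    · intro s t has hst htb
      rw [one_mul, abs_of_nonneg (by linarith)]

/-- The hypotheses of `exists_mem_graph_setIntegral` suffice for `E` to represent `A`, by letting
`(a, b]` exhaust the line; that no vector is missing from the domain is the closedness of `A`. -/
theorem represents_of_slab (hA : IsSelfAdjoint A)
    (hcomm : ∀ t x y, (x, y) ∈ A.graph → (E.proj t x, E.proj t y) ∈ A.graph)
    (hslab : ∀ a b, a ≤ b → ∀ x, E.proj a x = 0 → E.proj b x = x →
      ∃ y, (x, y) ∈ A.graph ∧ ‖y - (((a + b) / 2 : ℝ) : 𝕜) • x‖ ≤ (b - a) / 2 * ‖x‖) :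
    E.Represents A := by
  have hint := fun x (n : ℕ) => exists_mem_graph_setIntegral hcomm hslab x
    (a := -(n : ℝ)) (b := n) (by have : (0 : ℝ) ≤ n := n.cast_nonneg; linarith)
  choose y hy hy2 hy1 using hint
  have hN : Tendsto (fun n : ℕ => (n : ℝ)) atTop atTop := tendsto_natCast_atTop_atTop
  have hN' : Tendsto (fun n : ℕ => -(n : ℝ)) atTop atBot := tendsto_neg_atTop_atBot.comp hN
  have hcover : ∀ ν : Measure ℝ, AECover ν atTop fun n : ℕ => Set.Ioc (-(n : ℝ)) n :=
    fun ν => aecover_Ioc hN' hN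
  have htrunc : ∀ x, Tendsto (fun n : ℕ => E.proj n x - E.proj (-(n : ℝ)) x) atTop (𝓝 x) := by
    intro x
    simpa using ((E.tendsto_atTop x).comp hN).sub ((E.tendsto_atBot x).comp hN')
  have hfwd : ∀ x : A.domain, Integrable (fun t : ℝ => t ^ 2) (E.measure (x : H)) ∧
      ‖A x‖ ^ 2 = ∫ t : ℝ, t ^ 2 ∂(E.measure (x : H)) ∧
      Integrable (fun t : ℝ => t) (E.measure (x : H)) ∧
      inner 𝕜 (A x) (x : H) = ((∫ t : ℝ, t ∂(E.measure (x : H)) : ℝ) : 𝕜) := by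
    intro x
    have hx := A.mem_graph x
    have hyx : ∀ n : ℕ, y x n = E.proj n (A x) - E.proj (-(n : ℝ)) (A x) := fun n =>
      A.mem_graph_snd_inj (hy x n) (A.graph.sub_mem (hcomm _ _ _ hx) (hcomm _ _ _ hx)) rfl
    have hlim : Tendsto (y x) atTop (𝓝 (A x)) := (htrunc (A x)).congr fun n => (hyx n).symm
    have hint2 : Integrable (fun t : ℝ => t ^ 2) (E.measure (x : H)) := by
      refine (hcover _).integrable_of_integral_norm_bounded (‖A x‖ ^ 2) (fun n => ?_)
        (.of_forall fun n => ?_)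
      · exact ((continuous_pow 2).continuousOn.integrableOn_Icc).mono_set Set.Ioc_subset_Icc_self
      · simp only [norm_pow, Real.norm_eq_abs, sq_abs]
        rw [← hy2, hyx]
        refine pow_le_pow_left₀ (norm_nonneg _) ?_ 2
        exact (E.isStarProjection_sub (by
          have : (0 : ℝ) ≤ n := n.cast_nonneg
          linarith)).norm_apply_le (A x)
    have hint1 := integrable_id_of_integrable_sq hint2
    refine ⟨hint2, ?_, hint1, ?_⟩
    · refine tendsto_nhds_unique (hlim.norm.pow 2) ?_
      exact ((hcover _).integral_tendsto_of_countably_generated hint2).congr fun n => (hy2 x n).symm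
    · have h1 : RCLike.re (inner 𝕜 (A x) (x : H)) = ∫ t : ℝ, t ∂(E.measure (x : H)) := by
        refine tendsto_nhds_unique
          ((RCLike.continuous_re.tendsto _).comp (hlim.inner (htrunc (x : H)))) ?_
        exact ((hcover _).integral_tendsto_of_countably_generated hint1).congr
          fun n => (hy1 x n).symm
      rw [← h1, eq_comm, ← RCLike.conj_eq_iff_re, inner_conj_symm]
      exact (hA.inner_graph hx hx).symm
  refine ⟨fun x => ⟨fun hx => (hfwd ⟨x, hx⟩).1, fun hx => ?_⟩, fun x => (hfwd x).2⟩
  have hbound : ∀ n, ‖y x n - ((0 : ℝ) : 𝕜) • (E.proj n x - E.proj (-(n : ℝ)) x)‖ ≤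
      Real.sqrt (∫ t : ℝ, t ^ 2 ∂(E.measure x)) := fun n => by
    rw [RCLike.ofReal_zero, zero_smul, sub_zero]
    refine Real.le_sqrt_of_sq_le ?_
    rw [hy2]
    exact setIntegral_le_integral hx (.of_forall fun t => sq_nonneg t)
  obtain ⟨z, hz, -⟩ :=
    hA.exists_mem_graph_of_tendsto (htrunc x) (hy x) hbound tendsto_const_nhds
  exact LinearPMap.mem_domain_of_mem_graph hz

end SpectralFamily

/-- **Existence in the spectral theorem.** Besides representing `A`, the spectral family commutes
with every self-adjoint operator that preserves the graph of `A`. -/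
theorem IsSelfAdjoint.exists_represents {𝕜 H : Type*} [RCLike 𝕜] [NormedAddCommGroup H]
    [InnerProductSpace 𝕜 H] [CompleteSpace H] {A : H →ₗ.[𝕜] H} (hA : IsSelfAdjoint A) :
    ∃ E : SpectralFamily 𝕜 H, E.Represents A ∧ ∀ t Z, IsSelfAdjoint Z →
      (∀ x y, (x, y) ∈ A.graph → (Z x, Z y) ∈ A.graph) → Commute Z (E.proj t) := by
  obtain ⟨C, B, h⟩ := LinearPMap.exists_isSqResolvent hA
  obtain ⟨E, hE, hslab⟩ := h.exists_spectralFamily hA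
  have hC := h.isPositive hA
  have hB := h.isSelfAdjoint_right hA
  have hBC := h.commute hA
  have hEC : ∀ t, Commute (E.proj t) C := fun t =>
    (hE t C hC.isSelfAdjoint (Commute.refl C) hBC.symm).symm
  have hEB : ∀ t, Commute (E.proj t) B := fun t => (hE t B hB hBC (Commute.refl B)).symm
  refine ⟨E, E.represents_of_slab hA (fun t x y => h.mem_graph_of_commute hA (hEC t) (hEB t))
    fun a b hab x hxa hxb => ?_, fun t Z hZ hZA => ?_⟩
  · -- The range of `C` is dense, so `x` is a limit of vectors `C z` with `z` in the same slab.
    have hdense : DenseRange C := by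
      have h1 : (LinearMap.range (C : H →ₗ[𝕜] H)).topologicalClosure = ⊤ := by
        rw [Submodule.topologicalClosure_eq_top_iff, Submodule.eq_bot_iff]
        intro z hz
        refine h.eq_zero_of_apply_eq_zero ((inner_self_eq_zero (𝕜 := 𝕜)).1 ?_)
        rw [hC.inner_left_eq_inner_right, ← inner_conj_symm]
        exact (congrArg _ (hz (C (C z)) ⟨C z, rfl⟩)).trans (map_zero _)
      exact Submodule.dense_iff_topologicalClosure_eq_top.2 h1
    obtain ⟨v, hv, hvx⟩ := mem_closure_iff_seq_limit.1 (hdense x)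
    choose z hz using hv
    let w : ℕ → H := fun n => E.proj b (z n) - E.proj a (z n)
    have hCw : ∀ n, C (w n) = E.proj b (v n) - E.proj a (v n) := fun n => by
      rw [← hz, (hEC b).operator_apply, (hEC a).operator_apply, map_sub]
    have hlim : Tendsto (fun n => C (w n)) atTop (𝓝 x) := by
      have h1 := (((E.proj b).continuous.tendsto x).comp hvx).sub
        (((E.proj a).continuous.tendsto x).comp hvx)
      rw [hxa, hxb, sub_zero] at h1
      exact h1.congr fun n => (hCw n).symm
    refine hA.exists_mem_graph_of_tendsto hlim (fun n => h.mem_graph (w n)) (fun n => ?_)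
      (hlim.norm.const_mul ((b - a) / 2))
    refine hslab a b hab (w n) ?_ ?_
    · rw [map_sub, (E.isStarProjection a).apply_apply, E.proj_proj_of_le hab, sub_self]
    · rw [map_sub, (E.isStarProjection b).apply_apply, E.proj_proj_of_ge hab]
  · obtain ⟨h1, h2⟩ := h.commute_of_forall_mem_graph hA hZA
    exact hE t Z hZ h1 h2

/-! ### Spectral families representing a given operator -/

namespace SpectralFamily.Represents

variable {𝕜 H : Type*} [RCLike 𝕜] [NormedAddCommGroup H] [InnerProductSpace 𝕜 H]
  [CompleteSpace H] {A : H →ₗ.[𝕜] H} {E : SpectralFamily 𝕜 H}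

theorem inner_eq_integral (hE : E.Represents A) {x y : H} (hxy : (x, y) ∈ A.graph) :
    Integrable (fun t : ℝ => t) (E.measure x) ∧
      inner 𝕜 y x = ((∫ t : ℝ, t ∂(E.measure x) : ℝ) : 𝕜) := by
  obtain ⟨u, rfl, rfl⟩ := A.mem_graph_iff.1 hxy
  exact (hE.2 u).2

theorem norm_sq_eq_integral (hE : E.Represents A) {x y : H} (hxy : (x, y) ∈ A.graph) :
    ‖y‖ ^ 2 = ∫ t : ℝ, t ^ 2 ∂(E.measure x) := by
  obtain ⟨u, rfl, rfl⟩ := A.mem_graph_iff.1 hxy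
  exact (hE.2 u).1

/-- Polarization: if `x` and `w` are orthogonal for all the forms `⟪E(t) ·, ·⟫`, then the measures
of `x` and `w` add up to that of `x + w`, so that `A x` is orthogonal to `w`. -/
theorem inner_eq_zero (hE : E.Represents A) (hA : IsSelfAdjoint A) {x y w v : H}
    (hxy : (x, y) ∈ A.graph) (hwv : (w, v) ∈ A.graph) (h : ∀ t, inner 𝕜 (E.proj t x) w = 0) :
    inner 𝕜 y w = 0 := by
  have hre : ∀ {x y : H}, (x, y) ∈ A.graph → (∀ t, inner 𝕜 (E.proj t x) w = 0) →
      RCLike.re (inner 𝕜 y w) = 0 := by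
    intro x y hxy h
    obtain ⟨hx1, hx2⟩ := hE.inner_eq_integral hxy
    obtain ⟨hw1, hw2⟩ := hE.inner_eq_integral hwv
    obtain ⟨-, h2⟩ := hE.inner_eq_integral (A.graph.add_mem hxy hwv)
    rw [E.measure_add h, integral_add_measure hx1 hw1, RCLike.ofReal_add, ← hx2, ← hw2,
      inner_add_left, inner_add_right, inner_add_right] at h2
    have h3 : inner 𝕜 v x = starRingEnd 𝕜 (inner 𝕜 y w) := by
      rw [hA.inner_graph hwv hxy, inner_conj_symm]
    have h4 := congrArg RCLike.re h2
    rw [h3] at h4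
    simp only [map_add, RCLike.conj_re] at h4
    linarith
  -- Only the real part is visible to the quadratic form; rescaling `x` recovers the inner product.
  have h1 := hre (A.graph.smul_mem (inner 𝕜 y w) hxy) fun t => by
    rw [map_smul, inner_smul_left, h, mul_zero]
  change RCLike.re (inner 𝕜 (inner 𝕜 y w • y) w) = 0 at h1
  rw [inner_smul_left, RCLike.conj_mul, ← RCLike.ofReal_pow, RCLike.ofReal_re] at h1
  simpa using h1

theorem exists_proj_mem_graph (hE : E.Represents A) (c : ℝ) {x y : H} (hxy : (x, y) ∈ A.graph) :
    ∃ z, (E.proj c x, z) ∈ A.graph := by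
  refine LinearPMap.mem_domain_iff.1 ((hE.1 _).2 ?_)
  rw [E.measure_proj]
  exact ((hE.1 x).1 (LinearPMap.mem_domain_of_mem_graph hxy)).restrict

/-- A spectral family representing `A` commutes with `A`. -/
theorem proj_mem_graph (hE : E.Represents A) (hA : IsSelfAdjoint A) (c : ℝ) {x y : H}
    (hxy : (x, y) ∈ A.graph) : (E.proj c x, E.proj c y) ∈ A.graph := by
  obtain ⟨z, hz⟩ := hE.exists_proj_mem_graph c hxy
  have hdense := hA.dense_domain
  have h1 : ∀ q ∈ A.domain, inner 𝕜 (z - E.proj c z) q = 0 := by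
    intro q hq
    obtain ⟨p, hp⟩ := LinearPMap.mem_domain_iff.1 hq
    obtain ⟨r, hr⟩ := hE.exists_proj_mem_graph c hp
    have h2 := hE.inner_eq_zero hA hz (A.graph.sub_mem hp hr)
      fun t => E.inner_proj_proj_sub c t x q
    rw [inner_sub_left, (E.isStarProjection c).inner_left, ← inner_sub_right]
    exact h2
  have h2 : ∀ q ∈ A.domain, inner 𝕜 (E.proj c (y - z)) q = 0 := by
    intro q hq
    obtain ⟨p, hp⟩ := LinearPMap.mem_domain_iff.1 hq
    obtain ⟨r, hr⟩ := hE.exists_proj_mem_graph c hp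
    have h3 := hE.inner_eq_zero hA hr (A.graph.sub_mem hxy hz)
      fun t => E.inner_proj_proj_sub c t q x
    rw [(E.isStarProjection c).inner_left]
    exact (hA.inner_graph (A.graph.sub_mem hxy hz) hr).trans (by
      rw [← inner_conj_symm, h3, map_zero])
  have h3 := sub_eq_zero.1 (hdense.eq_zero_of_inner_left 𝕜 h1)
  have h4 := hdense.eq_zero_of_inner_left 𝕜 h2
  rw [map_sub, sub_eq_zero, ← h3] at h4
  rwa [h4]

theorem re_inner_le (hE : E.Represents A) {c : ℝ} {x y : H} (hxy : (x, y) ∈ A.graph)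
    (hx : E.proj c x = x) : RCLike.re (inner 𝕜 y x) ≤ c * ‖x‖ ^ 2 := by
  obtain ⟨h1, h2⟩ := hE.inner_eq_integral hxy
  have hae : ∀ᵐ t ∂(E.measure x), t ≤ c := by
    rw [← hx, E.measure_proj]
    exact ae_restrict_mem measurableSet_Iic
  rw [h2, RCLike.ofReal_re]
  refine (integral_mono_ae h1 (integrable_const c) hae).trans ?_
  rw [integral_const, E.measureReal_univ, smul_eq_mul, mul_comm]

theorem lt_re_inner (hE : E.Represents A) {c : ℝ} {x y : H} (hxy : (x, y) ∈ A.graph)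
    (hx : E.proj c x = 0) (hx0 : x ≠ 0) : c * ‖x‖ ^ 2 < RCLike.re (inner 𝕜 y x) := by
  obtain ⟨h1, h2⟩ := hE.inner_eq_integral hxy
  have hae : ∀ᵐ t ∂(E.measure x), c < t := by
    rw [← sub_zero x, ← hx, E.measure_sub_proj]
    exact ae_restrict_mem measurableSet_Ioi
  have h3 : 0 ≤ᵐ[E.measure x] fun t => t - c := by
    filter_upwards [hae] with t ht
    exact sub_nonneg.2 ht.le
  have h4 : ∫ t, (t - c) ∂(E.measure x) = RCLike.re (inner 𝕜 y x) - c * ‖x‖ ^ 2 := by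
    rw [integral_sub h1 (integrable_const c), integral_const, E.measureReal_univ, smul_eq_mul, h2,
      RCLike.ofReal_re, mul_comm]
  refine sub_pos.1 (h4 ▸ (integral_nonneg_of_ae h3).lt_of_ne' fun h5 => ?_)
  rw [integral_eq_zero_iff_of_nonneg_ae h3 (h1.sub (integrable_const c))] at h5
  have h6 : ∀ᵐ t ∂(E.measure x), False := by
    filter_upwards [h5, hae] with t ht ht'
    exact (sub_pos.2 ht').ne' ht
  rw [Filter.eventually_false_iff_eq_bot, ae_eq_bot] at h6
  have h7 := E.measureReal_univ x
  rw [h6] at h7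
  exact hx0 (by simpa using h7.symm)

/-- The form of `A - t` is at most `0` on the range of `E(t)` and positive on the kernel of `E'(t)`,
so these two subspaces meet trivially; as the projections commute, the range of `E(t)` lies in
that of `E'(t)`. -/
theorem proj_proj_eq (hE : E.Represents A) (hA : IsSelfAdjoint A) {E' : SpectralFamily 𝕜 H}
    (hE' : E'.Represents A) (t : ℝ) (hc : Commute (E.proj t) (E'.proj t)) (x : H) :
    E.proj t (E'.proj t x) = E.proj t x := by
  have hcl : IsClosed {x | E.proj t (E'.proj t x) = E.proj t x} :=
    isClosed_eq (by fun_prop) (by fun_prop)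
  refine hcl.closure_subset_iff.2 (fun x hx => ?_) (hA.dense_domain x)
  obtain ⟨y, hxy⟩ := LinearPMap.mem_domain_iff.1 hx
  have h1 := A.graph.sub_mem (hE.proj_mem_graph hA t hxy)
    (hE.proj_mem_graph hA t (hE'.proj_mem_graph hA t hxy))
  by_contra h2
  have h3 := hE.re_inner_le h1 (c := t) (by
    rw [map_sub, (E.isStarProjection t).apply_apply, (E.isStarProjection t).apply_apply])
  have h4 := hE'.lt_re_inner h1 (c := t) (by
    rw [map_sub, ← hc.operator_apply, ← hc.operator_apply, (E'.isStarProjection t).apply_apply,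
      sub_self]) (sub_ne_zero.2 (Ne.symm h2))
  exact h3.not_gt h4

theorem eq_of_commute (hE : E.Represents A) (hA : IsSelfAdjoint A) {E' : SpectralFamily 𝕜 H}
    (hE' : E'.Represents A) (hc : ∀ t, Commute (E.proj t) (E'.proj t)) : E = E' := by
  have h : E.proj = E'.proj := by
    ext t x
    rw [← hE.proj_proj_eq hA hE' t (hc t), (hc t).operator_apply,
      hE'.proj_proj_eq hA hE t (hc t).symm]
  cases E
  cases E'
  congr

/-! ### Nonnegative operators -/

theorem proj_eq_zero_of_neg (hE : E.Represents A) (hA : IsSelfAdjoint A) (hpos : A.IsNonneg)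
    {c : ℝ} (hc : c < 0) (x : H) : E.proj c x = 0 := by
  have hcl : IsClosed {x | E.proj c x = 0} := isClosed_eq (by fun_prop) (by fun_prop)
  refine hcl.closure_subset_iff.2 (fun x hx => ?_) (hA.dense_domain x)
  obtain ⟨y, hxy⟩ := LinearPMap.mem_domain_iff.1 hx
  have h1 := hE.proj_mem_graph hA c hxy
  have h2 := hE.re_inner_le h1 ((E.isStarProjection c).apply_apply x)
  obtain ⟨u, hu, hu'⟩ := A.mem_graph_iff.1 h1
  have h3 := hpos u
  dsimp only at hu hu'
  rw [hu', hu] at h3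
  have h4 : ‖E.proj c x‖ ^ 2 = 0 := by nlinarith [sq_nonneg ‖E.proj c x‖]
  simpa using h4

theorem exists_mem_graph_norm_le (hE : E.Represents A) (hA : IsSelfAdjoint A)
    (hpos : A.IsNonneg) {c : ℝ} (hc : 0 ≤ c) {x : H} (hx : E.proj c x = x) :
    ∃ y, (x, y) ∈ A.graph ∧ ‖y‖ ≤ c * ‖x‖ ∧ E.proj c y = y := by
  have hle : ∀ᵐ t ∂(E.measure x), t ≤ c := by
    rw [← hx, E.measure_proj]
    exact ae_restrict_mem measurableSet_Iic
  have hge : ∀ᵐ t ∂(E.measure x), 0 ≤ t := by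
    have h1 : ∀ n : ℕ, ∀ᵐ t ∂(E.measure x), -(1 / ((n : ℝ) + 1)) < t := fun n => by
      have h2 := E.measure_sub_proj (-(1 / ((n : ℝ) + 1))) x
      rw [hE.proj_eq_zero_of_neg hA hpos (neg_neg_of_pos Nat.one_div_pos_of_nat), sub_zero] at h2
      rw [h2]
      exact ae_restrict_mem measurableSet_Ioi
    filter_upwards [ae_all_iff.2 h1] with t ht
    have h3 := tendsto_one_div_add_atTop_nhds_zero_nat (𝕜 := ℝ) |>.neg
    rw [neg_zero] at h3
    exact le_of_tendsto' h3 fun n => (ht n).le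
  have hsq : ∀ᵐ t ∂(E.measure x), t ^ 2 ≤ c ^ 2 := by
    filter_upwards [hle, hge] with t h1 h2
    exact pow_le_pow_left₀ h2 h1 2
  have hint : Integrable (fun t : ℝ => t ^ 2) (E.measure x) := by
    refine (integrable_const (c ^ 2)).mono' (by fun_prop) ?_
    filter_upwards [hsq] with t ht
    rwa [Real.norm_eq_abs, abs_of_nonneg (sq_nonneg t)]
  obtain ⟨y, hxy⟩ := LinearPMap.mem_domain_iff.1 ((hE.1 x).2 hint)
  refine ⟨y, hxy, ?_, A.mem_graph_snd_inj (hE.proj_mem_graph hA c hxy) hxy hx⟩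
  refine le_of_sq_le_sq ?_ (by positivity)
  rw [hE.norm_sq_eq_integral hxy, mul_pow]
  refine (integral_mono_ae hint (integrable_const (c ^ 2)) hsq).trans ?_
  rw [integral_const, E.measureReal_univ, smul_eq_mul, mul_comm]

theorem mul_norm_le (hE : E.Represents A) {c : ℝ} {x y : H} (hxy : (x, y) ∈ A.graph)
    (hx : E.proj c x = 0) : c * ‖x‖ ≤ ‖y‖ := by
  rcases eq_or_ne x 0 with rfl | hx0
  · rw [norm_zero, mul_zero]
    exact norm_nonneg y
  · have h1 := (hE.lt_re_inner hxy hx hx0).le.trans (re_inner_le_norm y x)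
    have h2 := norm_pos_iff.2 hx0
    rw [sq, ← mul_assoc] at h1
    exact le_of_mul_le_mul_right h1 h2

theorem isPowApply_sub_proj (hE : E.Represents A) (hA : IsSelfAdjoint A) (c : ℝ) {n : ℕ} {x y : H}
    (h : A.IsPowApply n x y) : A.IsPowApply n (x - E.proj c x) (y - E.proj c y) := by
  induction n generalizing y with
  | zero => rw [show y = x from h]; rfl
  | succ n ih =>
    obtain ⟨z, hz, hzA, rfl⟩ := h
    have h1 := A.mem_graph ⟨z, hzA⟩
    obtain ⟨u, hu, hu'⟩ := A.mem_graph_iff.1 (A.graph.sub_mem h1 (hE.proj_mem_graph hA c h1))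
    refine ⟨z - E.proj c z, ih hz, ?_⟩
    dsimp only [Prod.fst_sub, Prod.snd_sub] at hu hu'
    rw [← hu, ← hu']
    exact ⟨u.2, rfl⟩

theorem pow_mul_norm_le_of_isPowApply (hE : E.Represents A) (hA : IsSelfAdjoint A) {c : ℝ}
    (hc : 0 ≤ c) {x : H} (hx : E.proj c x = 0) {n : ℕ} {y : H} (h : A.IsPowApply n x y) :
    E.proj c y = 0 ∧ c ^ n * ‖x‖ ≤ ‖y‖ := by
  induction n generalizing y with
  | zero => rw [show y = x from h, pow_zero, one_mul]; exact ⟨hx, le_rfl⟩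
  | succ n ih =>
    obtain ⟨z, hz, hzA, rfl⟩ := h
    obtain ⟨h1, h2⟩ := ih hz
    have h3 := A.mem_graph ⟨z, hzA⟩
    refine ⟨A.graph_fst_eq_zero_snd (hE.proj_mem_graph hA c h3) h1, ?_⟩
    refine le_trans ?_ (hE.mul_norm_le h3 h1)
    rw [pow_succ', mul_assoc]
    exact mul_le_mul_of_nonneg_left h2 hc

/-- On the range of `E(l)` the spectral measures live on `[0, l]`, which gives the growth condition.
Conversely, for `c > l` the powers of `A` grow at least like `c ^ n` on the kernel of `E(c)`, so a
vector in the growth set has no component there. -/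
theorem range_proj_eq_growthSet (hE : E.Represents A) (hA : IsSelfAdjoint A) (hpos : A.IsNonneg)
    (l : ℝ) : (Set.range (E.proj l) : Set H) = A.growthSet l := by
  rcases lt_or_ge l 0 with hl | hl
  · -- Both sides are `{0}`, on the right because of the growth condition for `n = 1`.
    have hz : ∀ n : ℕ, A.IsPowApply n 0 0 := fun n => by
      induction n with
      | zero => rfl
      | succ n ih => exact ⟨0, ih, A.domain.zero_mem, A.map_zero⟩
    ext x
    constructor
    · rintro ⟨z, rfl⟩ n
      rw [hE.proj_eq_zero_of_neg hA hpos hl]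
      exact ⟨0, hz n, by simp⟩
    · intro hx
      obtain ⟨y, -, hy⟩ := hx 1
      have h1 : ‖x‖ = 0 := by nlinarith [norm_nonneg x, norm_nonneg y]
      exact ⟨0, by rw [map_zero, norm_eq_zero.1 h1]⟩
  · ext x
    constructor
    · rintro ⟨z, rfl⟩ n
      suffices h : ∃ y, A.IsPowApply n (E.proj l z) y ∧ ‖y‖ ≤ l ^ n * ‖E.proj l z‖ ∧
          E.proj l y = y by
        obtain ⟨y, h1, h2, -⟩ := h
        exact ⟨y, h1, h2⟩
      induction n with
      | zero => exact ⟨_, rfl, by simp, (E.isStarProjection l).apply_apply z⟩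
      | succ n ih =>
        obtain ⟨y, h1, h2, h3⟩ := ih
        obtain ⟨w, hw, hw', hw3⟩ := hE.exists_mem_graph_norm_le hA hpos hl h3
        obtain ⟨u, hu, hu'⟩ := A.mem_graph_iff.1 hw
        dsimp only at hu hu'
        subst hu hu'
        refine ⟨A u, ⟨u, h1, u.2, rfl⟩, hw'.trans ?_, hw3⟩
        rw [pow_succ', mul_assoc]
        exact mul_le_mul_of_nonneg_left h2 hl
    · intro hx
      have h1 : ∀ c, l < c → E.proj c x = x := by
        intro c hc
        have hc0 : 0 < c := hl.trans_lt hc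
        have h2 : ∀ n : ℕ, ‖x - E.proj c x‖ ≤ (l / c) ^ n * ‖x‖ := fun n => by
          obtain ⟨y, hy, hyn⟩ := hx n
          have h3 := (hE.pow_mul_norm_le_of_isPowApply hA hc0.le
            (by rw [map_sub, (E.isStarProjection c).apply_apply, sub_self])
            (hE.isPowApply_sub_proj hA c hy)).2
          have h4 : ‖y - E.proj c y‖ ≤ ‖y‖ := by
            refine le_of_sq_le_sq ?_ (norm_nonneg y)
            rw [(E.isStarProjection c).norm_sub_sq]
            linarith [sq_nonneg ‖E.proj c y‖]
          rw [div_pow, div_mul_eq_mul_div, le_div_iff₀ (by positivity), mul_comm]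
          exact h3.trans (h4.trans hyn)
        have h3 : Tendsto (fun n : ℕ => (l / c) ^ n * ‖x‖) atTop (𝓝 0) := by
          simpa using (tendsto_pow_atTop_nhds_zero_of_lt_one (div_nonneg hl hc0.le)
            ((div_lt_one hc0).2 hc)).mul_const ‖x‖
        have h4 := ge_of_tendsto' h3 h2
        exact (sub_eq_zero.1 (norm_le_zero_iff.1 h4)).symm
      refine ⟨x, tendsto_nhds_unique (E.right_continuous l x) (tendsto_const_nhds.congr' ?_)⟩
      filter_upwards [self_mem_nhdsWithin] with c hc
      exact (h1 c hc).symm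

end SpectralFamily.Represents

theorem theorem1 {𝕜 H : Type*} [RCLike 𝕜] [NormedAddCommGroup H] [InnerProductSpace 𝕜 H]
    [CompleteSpace H] (A : H →ₗ.[𝕜] H) (hA : IsSelfAdjoint A) :
    (∃! E : SpectralFamily 𝕜 H, E.Represents A) ∧
    (A.IsNonneg → ∃ E : SpectralFamily 𝕜 H, E.Represents A ∧
      ∀ l : ℝ, (Set.range (E.proj l) : Set H) = A.growthSet l) := by
  obtain ⟨E, hE, hcomm⟩ := hA.exists_represents
  refine ⟨⟨E, hE, fun E' hE' => ?_⟩, fun hpos => ⟨E, hE, hE.range_proj_eq_growthSet hA hpos⟩⟩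
  exact hE'.eq_of_commute hA hE fun t => hcomm t _ (E'.isStarProjection t).isSelfAdjoint
    fun _ _ hxy => hE'.proj_mem_graph hA t hxy
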